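/- A linear system is a pair $(P,\mathcal L)$, where $P$ is a finite set (of points) and $\mathcal L$ is a family of subsets of $P$ (called lines) such that $|l\cap l'|\le 1$ for all distinct $l,l'\in\mathcal L$; it is intersecting if $|l\cap l'|=1$ for all distinct $l,l'\in\mathcal L$. Its transversal number $\tau$ is the minimum cardinality of a set $T\subseteq P$ that meets every line in $\mathcal L$, and its 2-packing number $\nu_2$ is the maximum cardinality of a set $R\subseteq\mathcal L$ such that no three different elements of $R$ have a common point. For an integer $r\ge 2$, an $r$-segment system is a linear system $(P,\mathcal L)$ with $P\subseteq\mathbb Z^2$ such that every $l\in\mathcal L$ consists of $r$ consecutive integer points (i.e. consecutive points of $\mathbb Z^2$) on some straight line of $\mathbb R^2$, and every straight line of $\mathbb R^2$ contains at most one element of $\mathcal L$. Let $(P,\mathcal L)$ be an intersecting $r$-segment system with $r=\nu_2\ge 3$, where $\nu_2=\nu_2(P,\mathcal L)$ is its own 2-packing number. Then $$|\mathcal L|\le\frac{3\nu_2+1}{2}\qquad\text{and}\qquad \tau\le\frac23(\nu_2+1).$$ -/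

import Mathlib

/-- A linear system: a finite ground set of points and a family of subsets of it (the lines),
any two distinct ones of which share at most one point. -/
structure LinearSystem (α : Type*) [DecidableEq α] where
  points : Finset α
  lines : Finset (Finset α)
  subset_points : ∀ l ∈ lines, l ⊆ points
  card_inter_le_one : ∀ l ∈ lines, ∀ m ∈ lines, l ≠ m → (l ∩ m).card ≤ 1

namespace LinearSystem

variable {α : Type*} [DecidableEq α]

/-- Any two distinct lines share exactly one point. -/
def IsIntersecting (S : LinearSystem α) : Prop :=
  ∀ l ∈ S.lines, ∀ m ∈ S.lines, l ≠ m → (l ∩ m).card = 1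

/-- A transversal: a set of points of the system that meets every line. -/
def IsTransversal (S : LinearSystem α) (T : Finset α) : Prop :=
  T ⊆ S.points ∧ ∀ l ∈ S.lines, (T ∩ l).Nonempty

/-- The transversal number `τ`: the least cardinality of a transversal. (If all lines are
nonempty, then the set of all points is a transversal, so the infimum is attained.) -/
noncomputable def transversalNumber (S : LinearSystem α) : ℕ :=
  sInf {k : ℕ | ∃ T : Finset α, S.IsTransversal T ∧ T.card = k}

/-- A 2-packing: a set of lines no three different elements of which have a common point. -/
def IsTwoPacking (S : LinearSystem α) (R : Finset (Finset α)) : Prop :=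
  R ⊆ S.lines ∧ ∀ a ∈ R, ∀ b ∈ R, ∀ c ∈ R, a ≠ b → a ≠ c → b ≠ c → a ∩ b ∩ c = ∅

/-- The 2-packing number `ν₂`: the maximum cardinality of a 2-packing (the empty set is a
2-packing and the cardinalities are bounded by the number of lines). -/
noncomputable def twoPackingNumber (S : LinearSystem α) : ℕ :=
  sSup {k : ℕ | ∃ R : Finset (Finset α), S.IsTwoPacking R ∧ R.card = k}

end LinearSystem

/-- The inclusion of the integer points in the real plane. -/
def intPoint (p : ℤ × ℤ) : ℝ × ℝ := ((p.1 : ℝ), (p.2 : ℝ))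

/-- A straight line of the real plane: a one-dimensional affine subspace. -/
def IsPlaneLine (M : AffineSubspace ℝ (ℝ × ℝ)) : Prop :=
  Module.finrank ℝ M.direction = 1

/-- `l` consists of `r` consecutive integer points on the line `M`: it is a set of `r` integer
points of `M` that contains every integer point lying between two of its elements. -/
def IsConsecutiveOn (M : AffineSubspace ℝ (ℝ × ℝ)) (r : ℕ) (l : Finset (ℤ × ℤ)) : Prop :=
  l.card = r ∧ (∀ p ∈ l, intPoint p ∈ M) ∧
    ∀ p ∈ l, ∀ q ∈ l, ∀ z : ℤ × ℤ, intPoint z ∈ segment ℝ (intPoint p) (intPoint q) → z ∈ l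

/-- An `r`-segment system: `r ≥ 2`, every line of the system consists of `r` consecutive integer
points on some straight line of the plane, and every straight line of the plane contains at most
one line of the system. -/
def IsSegmentSystem (r : ℕ) (S : LinearSystem (ℤ × ℤ)) : Prop :=
  2 ≤ r ∧
  (∀ l ∈ S.lines, ∃ M : AffineSubspace ℝ (ℝ × ℝ), IsPlaneLine M ∧ IsConsecutiveOn M r l) ∧
  (∀ M : AffineSubspace ℝ (ℝ × ℝ), IsPlaneLine M → ∀ l ∈ S.lines, ∀ m ∈ S.lines,
    (∀ p ∈ l, intPoint p ∈ M) → (∀ p ∈ m, intPoint p ∈ M) → l = m)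

/-! Let `R` be a maximum 2-packing and let `r ≥ 4`. Its `r` lines have `r` points each, any two meet
and no three concur, so on each line the others occupy `r - 1` different points and exactly one
point stays free. This rigidity determines the straight lines carrying `R`: in suitable lattice
coordinates they are the tangents `y = i (x - i)`, `0 ≤ i < r`, of one parabola. Tangent `i` is
traversed by `(i + t, i t)` and meets tangent `j` at `t = j` (`IsTightArrangement.exists_chain`).

The coordinates come from two lines of `R` whose steps have least determinant. Minimality makes a
third line that cuts one axis next to the origin cut the other at distance at most two
(`IsMinFrame.exists_right_le_two`). Divisibility arguments then produce three consecutive tangents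
(`IsTightArrangement.exists_chain_two`), and a chain that cannot be prolonged exhausts `R`
(`IsParabolicChain.card_le_of_maximal`).

A line of the system outside `R` meets every tangent at an integral position. The position is a
Möbius function of `i` that is its own inverse, so away from its pole it cannot skip integers and
moves by exactly one. This forces the direction of the axis of the parabola or, for `r = 4` only,
that of the tangent at parameter `3/2` (`IsIntegralSecant.eq_zero`,
`IsIntegralSecant.eq_zero_or_of_four`). Lines of the system are never parallel, so at most one line
is added to `R`, or two if `r = 4`. For `r = 3`, exchanging lines of a triangle leaves at most four
lines (`LinearSystem.card_lines_le_four`).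

So there are at most `r + 1` lines, or at most six if `r = 4`; this gives the first inequality, and
meeting the lines in pairs (`LinearSystem.exists_pairing`) gives the second. -/

/-! ### Integer determinants, affine frames and progressions -/

/-- The determinant of two integer vectors. -/
def cross (a b : ℤ × ℤ) : ℤ := a.1 * b.2 - a.2 * b.1

/-- The point with coordinates `(x, y)` in the affine frame `(O, e, f)`. -/
def framePoint (O e f : ℤ × ℤ) (x y : ℤ) : ℤ × ℤ := O + x • e + y • f

/-- `l` consists of the points `p + t • d` with `w ≤ t < w + r`. -/
def IsProgression (r : ℕ) (l : Finset (ℤ × ℤ)) (p d : ℤ × ℤ) (w : ℤ) : Prop :=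
  d ≠ 0 ∧ ∀ x, x ∈ l ↔ ∃ t, w ≤ t ∧ t < w + r ∧ x = p + t • d

/-- `l` is a progression of length `r` with base point `p` and step `d`. -/
def SegOn (r : ℕ) (l : Finset (ℤ × ℤ)) (p d : ℤ × ℤ) : Prop :=
  ∃ w, IsProgression r l p d w

theorem framePoint_inj {O e f : ℤ × ℤ} (h : cross e f ≠ 0) {x y x' y' : ℤ}
    (hxy : framePoint O e f x y = framePoint O e f x' y') : x = x' ∧ y = y' := by
  simp only [framePoint, Prod.ext_iff, Prod.fst_add, Prod.snd_add, Prod.smul_fst, Prod.smul_snd,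
    smul_eq_mul] at hxy
  obtain ⟨h1, h2⟩ := hxy
  unfold cross at h
  constructor
  · have : (x - x') * (e.1 * f.2 - e.2 * f.1) = 0 := by
      linear_combination f.2 * h1 - f.1 * h2
    rcases mul_eq_zero.mp this with h0 | h0
    · omega
    · exact absurd h0 h
  · have : (y - y') * (e.1 * f.2 - e.2 * f.1) = 0 := by
      linear_combination e.1 * h2 - e.2 * h1
    rcases mul_eq_zero.mp this with h0 | h0
    · omega
    · exact absurd h0 h

theorem smul_right_inj_int {d : ℤ × ℤ} (hd : d ≠ 0) {s t : ℤ} (h : s • d = t • d) : s = t :=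
  smul_left_injective ℤ hd h

namespace SegOn

variable {r : ℕ} {l : Finset (ℤ × ℤ)} {p d q : ℤ × ℤ}

theorem step_ne_zero (h : SegOn r l p d) : d ≠ 0 := h.choose_spec.1

theorem exists_window (h : SegOn r l p d) :
    ∃ w : ℤ, ∀ t : ℤ, p + t • d ∈ l ↔ w ≤ t ∧ t < w + r := by
  obtain ⟨w, hd, hw⟩ := h
  refine ⟨w, fun t => ?_⟩
  rw [hw]
  constructor
  · rintro ⟨s, h1, h2, h3⟩
    have := smul_right_inj_int hd (add_left_cancel h3)
    omega
  · rintro ⟨h1, h2⟩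
    exact ⟨t, h1, h2, rfl⟩

theorem exists_eq (h : SegOn r l p d) (hq : q ∈ l) : ∃ t : ℤ, q = p + t • d := by
  obtain ⟨w, hd, hw⟩ := h
  obtain ⟨t, -, -, ht⟩ := (hw q).1 hq
  exact ⟨t, ht⟩

theorem shift (h : SegOn r l p d) (s : ℤ) : SegOn r l (p + s • d) d := by
  obtain ⟨w, hd, hw⟩ := h
  refine ⟨w - s, hd, fun x => ?_⟩
  rw [hw]
  constructor
  · rintro ⟨t, h1, h2, rfl⟩
    exact ⟨t - s, by omega, by omega, by rw [sub_smul]; abel⟩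
  · rintro ⟨t, h1, h2, rfl⟩
    exact ⟨t + s, by omega, by omega, by rw [add_smul]; abel⟩

theorem neg (h : SegOn r l p d) : SegOn r l p (-d) := by
  obtain ⟨w, hd, hw⟩ := h
  refine ⟨1 - w - r, neg_ne_zero.mpr hd, fun x => ?_⟩
  rw [hw]
  constructor
  · rintro ⟨t, h1, h2, rfl⟩
    exact ⟨-t, by omega, by omega, by simp⟩
  · rintro ⟨t, h1, h2, rfl⟩
    exact ⟨-t, by omega, by omega, by simp⟩

theorem rebase (h : SegOn r l p d) (hq : q ∈ l) : SegOn r l q d := by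
  obtain ⟨t, rfl⟩ := h.exists_eq hq
  exact h.shift t

theorem between (h : SegOn r l p d) {a b c : ℤ} (ha : p + a • d ∈ l) (hc : p + c • d ∈ l)
    (hab : a ≤ b) (hbc : b ≤ c) : p + b • d ∈ l := by
  obtain ⟨w, hw⟩ := h.exists_window
  rw [hw] at *
  omega

theorem cross_sub_eq_zero (h : SegOn r l p d) {x y z : ℤ × ℤ} (hx : x ∈ l) (hy : y ∈ l)
    (hz : z ∈ l) : cross (y - x) (z - x) = 0 := by
  obtain ⟨a, rfl⟩ := h.exists_eq hx
  obtain ⟨b, rfl⟩ := h.exists_eq hy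
  obtain ⟨c, rfl⟩ := h.exists_eq hz
  simp [cross]
  ring

theorem collinear (h : SegOn r l p d) {O e f : ℤ × ℤ} (hef : cross e f ≠ 0)
    {x₁ y₁ x₂ y₂ x₃ y₃ : ℤ} (h₁ : framePoint O e f x₁ y₁ ∈ l) (h₂ : framePoint O e f x₂ y₂ ∈ l)
    (h₃ : framePoint O e f x₃ y₃ ∈ l) :
    (x₂ - x₁) * (y₃ - y₁) = (x₃ - x₁) * (y₂ - y₁) := by
  have := h.cross_sub_eq_zero h₁ h₂ h₃
  have h0 : ((x₂ - x₁) * (y₃ - y₁) - (x₃ - x₁) * (y₂ - y₁)) * cross e f = 0 := by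
    rw [← this]
    simp [cross, framePoint]
    ring
  rcases mul_eq_zero.mp h0 with h0 | h0
  · linarith
  · exact absurd h0 hef

theorem cross_eq_zero (h : SegOn r l p d) {p' d' : ℤ × ℤ} (h' : SegOn r l p' d') (hr : 2 ≤ r) :
    cross d d' = 0 := by
  obtain ⟨w, hw⟩ := h'.exists_window
  obtain ⟨s, hs⟩ := h.exists_eq ((hw w).2 (by omega))
  obtain ⟨t, ht⟩ := h.exists_eq ((hw (w + 1)).2 (by omega))
  have : d' = (t - s) • d := by
    rw [sub_smul, ← add_sub_add_left_eq_sub _ _ p, ← hs, ← ht, add_smul]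
    simp
  rw [this]
  simp [cross]
  ring

end SegOn

/-! ### Tight arrangements and frames of least determinant -/

/-- A family of progressions of length `r`, pairwise nonparallel and pairwise meeting in a
unique point. -/
structure IsArrangement (r : ℕ) (L : Finset (Finset (ℤ × ℤ))) : Prop where
  two_le : 2 ≤ r
  seg : ∀ l ∈ L, ∃ p d, SegOn r l p d
  meet : ∀ l ∈ L, ∀ m ∈ L, l ≠ m → ∃ x, x ∈ l ∧ x ∈ m
  cross_ne : ∀ l ∈ L, ∀ m ∈ L, l ≠ m → ∀ p d p' d', SegOn r l p d → SegOn r m p' d' →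
    cross d d' ≠ 0

/-- An arrangement of `r` progressions of length `r`, no three of them with a common point. -/
structure IsTightArrangement (r : ℕ) (R : Finset (Finset (ℤ × ℤ))) : Prop
    extends IsArrangement r R where
  card_eq : R.card = r
  simple : ∀ a ∈ R, ∀ b ∈ R, ∀ c ∈ R, a ≠ b → a ≠ c → b ≠ c → ∀ x, x ∈ a → x ∈ b → x ∉ c

theorem IsArrangement.exists_mem {r : ℕ} {L : Finset (Finset (ℤ × ℤ))} (hL : IsArrangement r L)
    {l m : Finset (ℤ × ℤ)} (hl : l ∈ L) (hm : m ∈ L) (hlm : l ≠ m) {p d : ℤ × ℤ}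
    (h : SegOn r l p d) : ∃ t : ℤ, p + t • d ∈ l ∧ p + t • d ∈ m := by
  obtain ⟨x, hx, hx'⟩ := hL.meet l hl m hm hlm
  obtain ⟨t, rfl⟩ := h.exists_eq hx
  exact ⟨t, hx, hx'⟩

theorem IsArrangement.mem_unique {r : ℕ} {L : Finset (Finset (ℤ × ℤ))} (hL : IsArrangement r L)
    {l m : Finset (ℤ × ℤ)} (hl : l ∈ L) (hm : m ∈ L) (hlm : l ≠ m) {x y : ℤ × ℤ}
    (hx : x ∈ l) (hx' : x ∈ m) (hy : y ∈ l) (hy' : y ∈ m) : x = y := by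
  obtain ⟨p, d, h⟩ := hL.seg l hl
  obtain ⟨p', d', h'⟩ := hL.seg m hm
  have hc := hL.cross_ne l hl m hm hlm _ _ _ _ h h'
  obtain ⟨s, rfl⟩ := (h.rebase hx).exists_eq hy
  obtain ⟨t, ht⟩ := (h'.rebase hx').exists_eq hy'
  have := add_left_cancel ht
  have e : framePoint 0 d d' s 0 = framePoint 0 d d' 0 t := by simp [framePoint, this]
  have := (framePoint_inj hc e).1
  simp [this]

/-- Pigeonhole: the `r - 1` other lines hit `l` in distinct points, as no three concur, and so leave
only one of its `r` points free. This is the main source of new lines below. -/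
theorem IsTightArrangement.exists_mem_or {r : ℕ} {R : Finset (Finset (ℤ × ℤ))}
    (hR : IsTightArrangement r R) {l : Finset (ℤ × ℤ)} (hl : l ∈ R) {x y : ℤ × ℤ}
    (hx : x ∈ l) (hy : y ∈ l) (hxy : x ≠ y) : ∃ m ∈ R, m ≠ l ∧ (x ∈ m ∨ y ∈ m) := by
  classical
  by_contra! hcon
  obtain ⟨p, d, h⟩ := hR.seg l hl
  have hcard : l.card = r := by
    obtain ⟨w, hd, hw⟩ := h
    have : l = (Finset.Ico w (w + r)).image fun t => p + t • d := by
      ext x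
      rw [hw]
      simp [and_assoc, eq_comm]
    rw [this, Finset.card_image_of_injective, Int.card_Ico]
    · omega
    · intro s t hst
      exact smul_right_inj_int hd (add_left_cancel hst)
  have hf : ∀ m ∈ R.erase l, ∃ z, z ∈ l ∧ z ∈ m := fun m hm =>
    hR.meet l hl m (Finset.mem_of_mem_erase hm) (Finset.ne_of_mem_erase hm).symm
  choose! f hfl hfm using hf
  have hlt : ((l.erase x).erase y).card < (R.erase l).card := by
    rw [Finset.card_erase_of_mem (by simp [hy, hxy.symm]), Finset.card_erase_of_mem hx,
      Finset.card_erase_of_mem hl, hcard, hR.card_eq]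
    have := hR.two_le
    omega
  have hmaps : ∀ m ∈ R.erase l, f m ∈ (l.erase x).erase y := by
    intro m hm
    have h1 := hcon m (Finset.mem_of_mem_erase hm) (Finset.ne_of_mem_erase hm)
    simp only [Finset.mem_erase]
    refine ⟨fun h => h1.2 (h ▸ hfm m hm), fun h => h1.1 (h ▸ hfm m hm), hfl m hm⟩
  obtain ⟨m, hm, n, hn, hmn, he⟩ := Finset.exists_ne_map_eq_of_card_lt_of_maps_to hlt hmaps
  exact hR.simple l hl m (Finset.mem_of_mem_erase hm) n (Finset.mem_of_mem_erase hn)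
    (Finset.ne_of_mem_erase hm).symm (Finset.ne_of_mem_erase hn).symm hmn (f m) (hfl m hm)
    (hfm m hm) (he ▸ hfm n hn)

/-- `μ` is a positive lower bound for the determinants of the steps of distinct members. -/
structure IsCrossBound (r : ℕ) (R : Finset (Finset (ℤ × ℤ))) (μ : ℤ) : Prop where
  pos : 0 < μ
  le : ∀ l ∈ R, ∀ m ∈ R, l ≠ m → ∀ p d p' d', SegOn r l p d → SegOn r m p' d' →
    μ ≤ |cross d d'|

/-- `j` and `k` are the axes of the frame `(O, e, f)`, of least possible determinant `μ`. -/
structure IsMinFrame (r : ℕ) (R : Finset (Finset (ℤ × ℤ))) (μ : ℤ) (j k : Finset (ℤ × ℤ))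
    (O e f : ℤ × ℤ) : Prop where
  bound : IsCrossBound r R μ
  left_mem : j ∈ R
  right_mem : k ∈ R
  left_seg : SegOn r j O e
  right_seg : SegOn r k O f
  origin_left : O ∈ j
  origin_right : O ∈ k
  abs_cross : |cross e f| = μ

/-- The frame need not generate `ℤ²`; all that is used later is that no two steps have a smaller
determinant. -/
theorem IsArrangement.exists_isMinFrame {r : ℕ} {R : Finset (Finset (ℤ × ℤ))}
    (hR : IsArrangement r R) (hcard : 1 < R.card) :
    ∃ μ j k O e f, IsMinFrame r R μ j k O e f := by
  classical
  let P : ℕ → Prop := fun n => ∃ j ∈ R, ∃ k ∈ R, j ≠ k ∧ ∃ p d p' d', SegOn r j p d ∧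
    SegOn r k p' d' ∧ (cross d d').natAbs = n
  have hP : ∃ n, P n := by
    obtain ⟨j, hj, k, hk, hjk⟩ := Finset.one_lt_card.mp hcard
    obtain ⟨p, d, h⟩ := hR.seg j hj
    obtain ⟨p', d', h'⟩ := hR.seg k hk
    exact ⟨_, j, hj, k, hk, hjk, p, d, p', d', h, h', rfl⟩
  obtain ⟨j, hj, k, hk, hjk, p, d, p', d', h, h', hn⟩ := Nat.find_spec hP
  obtain ⟨x, hx, hx'⟩ := hR.meet j hj k hk hjk
  refine ⟨|cross d d'|, j, k, x, d, d', ⟨?_, ?_⟩, hj, hk, h.rebase hx, h'.rebase hx', hx, hx', rfl⟩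
  · exact abs_pos.mpr (hR.cross_ne j hj k hk hjk _ _ _ _ h h')
  · intro l hl m hm hlm q c q' c' g g'
    have := Nat.find_min' hP ⟨l, hl, m, hm, hlm, q, c, q', c', g, g', rfl⟩
    rw [← hn] at this
    zify at this
    simpa using this

theorem cross_swap (a b : ℤ × ℤ) : cross a b = -cross b a := by
  simp [cross]; ring

theorem cross_neg_left (a b : ℤ × ℤ) : cross (-a) b = -cross a b := by
  simp [cross]; ring

theorem framePoint_neg_left (O e f : ℤ × ℤ) (x y : ℤ) :
    framePoint O (-e) f x y = framePoint O e f (-x) y := by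
  simp [framePoint]

theorem framePoint_neg_right (O e f : ℤ × ℤ) (x y : ℤ) :
    framePoint O e (-f) x y = framePoint O e f x (-y) := by
  simp [framePoint]

theorem framePoint_swap (O e f : ℤ × ℤ) (x y : ℤ) :
    framePoint O f e x y = framePoint O e f y x := by
  simp [framePoint, add_right_comm]

/-- Two lines with steps `d`, `d'` and axis intercepts `(a, b)`, `(a', b')` that have a point in
common: the position of that point on the first line. -/
theorem intercept_relation {O e f d d' : ℤ × ℤ} (h : cross e f ≠ 0) {a b c a' b' c' t t' : ℤ}
    (hc' : c' ≠ 0) (hd : c • d = a • e - b • f) (hd' : c' • d' = a' • e - b' • f)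
    (ht : framePoint O e f a 0 + t • d = framePoint O e f a' 0 + t' • d') :
    t * (a * b' - a' * b) = c * b' * (a' - a) := by
  have hd0 := hd
  have hd1 := hd'
  simp only [framePoint, Prod.ext_iff, Prod.fst_add, Prod.snd_add, Prod.smul_fst, Prod.smul_snd,
    smul_eq_mul, Prod.fst_sub, Prod.snd_sub] at ht hd0 hd1
  obtain ⟨h1, h2⟩ := ht
  obtain ⟨h3, h4⟩ := hd0
  obtain ⟨h5, h6⟩ := hd1
  have e1 : framePoint 0 e f (c * c' * a + c' * t * a) (-(c' * t * b)) =
      framePoint 0 e f (c * c' * a' + c * t' * a') (-(c * t' * b')) := by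
    ext
    · simp [framePoint]
      linear_combination c * c' * h1 - c' * t * h3 + c * t' * h5
    · simp [framePoint]
      linear_combination c * c' * h2 - c' * t * h4 + c * t' * h6
  obtain ⟨h7, h8⟩ := framePoint_inj h e1
  apply mul_left_cancel₀ hc'
  linear_combination b' * h7 + a' * h8

namespace IsMinFrame

variable {r : ℕ} {R : Finset (Finset (ℤ × ℤ))} {μ : ℤ} {j k : Finset (ℤ × ℤ)}
  {O e f : ℤ × ℤ}

theorem cross_ne (h : IsMinFrame r R μ j k O e f) : cross e f ≠ 0 := by
  have := h.bound.pos
  rw [← h.abs_cross] at this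
  exact abs_pos.mp this

theorem swap (h : IsMinFrame r R μ j k O e f) : IsMinFrame r R μ k j O f e :=
  ⟨h.bound, h.right_mem, h.left_mem, h.right_seg, h.left_seg, h.origin_right, h.origin_left, by
    rw [cross_swap, abs_neg, h.abs_cross]⟩

theorem neg_left (h : IsMinFrame r R μ j k O e f) : IsMinFrame r R μ j k O (-e) f :=
  ⟨h.bound, h.left_mem, h.right_mem, h.left_seg.neg, h.right_seg, h.origin_left, h.origin_right, by
    rw [cross_neg_left, abs_neg, h.abs_cross]⟩

theorem neg_right (h : IsMinFrame r R μ j k O e f) : IsMinFrame r R μ j k O e (-f) :=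
  h.swap.neg_left.swap

theorem ne (h : IsMinFrame r R μ j k O e f) (hR : IsTightArrangement r R) : j ≠ k := by
  rintro rfl
  exact h.cross_ne (h.left_seg.cross_eq_zero h.right_seg hR.two_le)

theorem framePoint_left (O e f : ℤ × ℤ) (a : ℤ) : framePoint O e f a 0 = O + a • e := by
  simp [framePoint]

theorem framePoint_right (O e f : ℤ × ℤ) (a : ℤ) : framePoint O e f 0 a = O + a • f := by
  simp [framePoint]

/-- The step of a line through `(a, 0)` and `(0, b)`. -/
theorem exists_step (h : IsMinFrame r R μ j k O e f) (hR : IsTightArrangement r R)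
    {l : Finset (ℤ × ℤ)} (hl : l ∈ R) (hlj : l ≠ j) (hlk : l ≠ k) {a b : ℤ} (ha : a ≠ 0)
    (hla : framePoint O e f a 0 ∈ l) (hlb : framePoint O e f 0 b ∈ l) :
    ∃ c d, SegOn r l (framePoint O e f a 0) d ∧ c • d = a • e - b • f ∧ c ≠ 0 ∧
      |c| ≤ |a| ∧ |c| ≤ |b| := by
  obtain ⟨p, d, hd⟩ := hR.seg l hl
  have hd := hd.rebase hla
  obtain ⟨t, ht⟩ := hd.exists_eq hlb
  have hc : (-t) • d = a • e - b • f := by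
    have : t • d = framePoint O e f 0 b - framePoint O e f a 0 := by rw [ht]; abel
    rw [neg_smul, this]
    simp [framePoint]
  have hc0 := hc
  simp only [Prod.ext_iff, Prod.fst_sub, Prod.snd_sub, Prod.smul_fst, Prod.smul_snd,
    smul_eq_mul] at hc0
  obtain ⟨h1, h2⟩ := hc0
  -- By Cramer's rule the intercepts `a` and `b` are `c = -t` times the ratios of determinants
  -- against the axes. These ratios are at least one in absolute value by minimality of `μ`, hence
  -- `|c| ≤ |a|` and `|c| ≤ |b|`.
  have ea : (-t) * cross d f = a * cross e f := by
    simp only [cross]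
    linear_combination f.2 * h1 - f.1 * h2
  have eb : (-t) * cross d e = b * cross e f := by
    simp only [cross]
    linear_combination e.2 * h1 - e.1 * h2
  have hμ := h.bound.pos
  have ba := h.bound.le l hl k h.right_mem hlk _ _ _ _ hd h.right_seg
  have bb := h.bound.le l hl j h.left_mem hlj _ _ _ _ hd h.left_seg
  have ea' := congrArg abs ea
  have eb' := congrArg abs eb
  rw [abs_mul, abs_mul, h.abs_cross] at ea' eb'
  refine ⟨-t, d, hd, hc, ?_, ?_, ?_⟩
  · intro h0
    rw [h0] at ea
    simp [ha, h.cross_ne] at ea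
  · have := mul_le_mul_of_nonneg_left ba (abs_nonneg (-t))
    rw [ea'] at this
    exact le_of_mul_le_mul_right this hμ
  · have := mul_le_mul_of_nonneg_left bb (abs_nonneg (-t))
    rw [eb'] at this
    exact le_of_mul_le_mul_right this hμ

theorem exists_left (h : IsMinFrame r R μ j k O e f) (hR : IsTightArrangement r R)
    {l : Finset (ℤ × ℤ)} (hl : l ∈ R) (hlj : l ≠ j) (hlk : l ≠ k) :
    ∃ a : ℤ, a ≠ 0 ∧ framePoint O e f a 0 ∈ j ∧ framePoint O e f a 0 ∈ l := by
  obtain ⟨a, ha, ha'⟩ := hR.exists_mem h.left_mem hl hlj.symm h.left_seg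
  refine ⟨a, ?_, by rwa [framePoint_left], by rwa [framePoint_left]⟩
  rintro rfl
  rw [zero_smul, add_zero] at ha ha'
  exact hR.simple j h.left_mem k h.right_mem l hl (h.ne hR) hlj.symm hlk.symm O h.origin_left
    h.origin_right ha'

theorem exists_right (h : IsMinFrame r R μ j k O e f) (hR : IsTightArrangement r R)
    {l : Finset (ℤ × ℤ)} (hl : l ∈ R) (hlj : l ≠ j) (hlk : l ≠ k) :
    ∃ b : ℤ, b ≠ 0 ∧ framePoint O e f 0 b ∈ k ∧ framePoint O e f 0 b ∈ l := by
  obtain ⟨b, hb, h1, h2⟩ := h.swap.exists_left hR hl hlk hlj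
  exact ⟨b, hb, by rwa [framePoint_swap] at h1, by rwa [framePoint_swap] at h2⟩

/-- With first intercept `1`, the bound `|c| ≤ |a|` leaves `c = ±1`: the two intercepts are
consecutive points of `l`. -/
theorem segOn_sub (h : IsMinFrame r R μ j k O e f) (hR : IsTightArrangement r R)
    {l : Finset (ℤ × ℤ)} (hl : l ∈ R) (hlj : l ≠ j) (hlk : l ≠ k) {b : ℤ}
    (hla : framePoint O e f 1 0 ∈ l) (hlb : framePoint O e f 0 b ∈ l) :
    SegOn r l (framePoint O e f 1 0) (e - b • f) := by
  obtain ⟨c, d, hd, hcd, hc, hc1, -⟩ := h.exists_step hR hl hlj hlk one_ne_zero hla hlb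
  rw [abs_one] at hc1
  have hc2 := abs_le.mp hc1
  rw [one_smul] at hcd
  rw [← hcd]
  obtain rfl | rfl : c = 1 ∨ c = -1 := by omega
  · simpa using hd
  · simpa using hd.neg

/-- Between the two points where a third line meets the axes at distance `1` and `b` from the
origin, no further line meets the second axis. -/
theorem notMem_of_lt (h : IsMinFrame r R μ j k O e f) (hR : IsTightArrangement r R)
    {l m : Finset (ℤ × ℤ)} (hl : l ∈ R) (hlj : l ≠ j) (hlk : l ≠ k) {b b' : ℤ}
    (hla : framePoint O e f 1 0 ∈ l) (hlb : framePoint O e f 0 b ∈ l) (hm : m ∈ R) (hmk : m ≠ k)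
    (h0 : 0 < b') (hb : b' < b) : framePoint O e f 0 b' ∉ m := by
  intro hmb
  have hef := h.cross_ne
  have hmj : m ≠ j := by
    rintro rfl
    obtain ⟨t, ht⟩ := h.left_seg.exists_eq hmb
    rw [← framePoint_left O e f] at ht
    have := (framePoint_inj hef ht).2
    omega
  have hlm : l ≠ m := by
    rintro rfl
    obtain ⟨p, d, hd⟩ := hR.seg l hl
    have := hd.collinear hef hla hlb hmb
    simp at this
    omega
  obtain ⟨a', ha', -, hma⟩ := h.exists_left hR hm hmj hmk
  obtain ⟨b₀, hb₀, hk₀, hl₀⟩ := h.exists_right hR hl hlj hlk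
  have hjl : framePoint O e f 1 0 ∈ j := by
    obtain ⟨a₀, ha₀, h1, h2⟩ := h.exists_left hR hl hlj hlk
    obtain ⟨p, d, hd⟩ := hR.seg l hl
    have := hd.collinear hef hla hlb h2
    simp at this
    rcases this with h3 | h3
    · rwa [show a₀ = 1 by omega] at h1
    · omega
  have ha1 : a' ≠ 1 := by
    rintro rfl
    exact hR.simple j h.left_mem l hl m hm hlj.symm hmj.symm hlm _ hjl hla hma
  obtain ⟨c, d, hd, hcd, hc, hc1, -⟩ := h.exists_step hR hl hlj hlk one_ne_zero hla hlb
  obtain ⟨c', d', hd', hcd', hc', -, -⟩ := h.exists_step hR hm hmj hmk ha' hma hmb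
  obtain ⟨t, ht, ht'⟩ := hR.exists_mem hl hm hlm hd
  obtain ⟨t', ht'⟩ := hd'.exists_eq ht'
  have key := intercept_relation hef hc' hcd hcd' ht'
  have hc2 : |c| = 1 := by
    have := abs_pos.mpr hc
    simp at hc1
    omega
  have k2 := congrArg abs key
  rw [abs_mul, abs_mul, abs_mul, hc2, one_mul, one_mul] at k2
  have ht0 : t ≠ 0 := by
    rintro rfl
    rw [abs_zero, zero_mul] at k2
    rcases mul_eq_zero.mp k2.symm with h3 | h3
    · rw [abs_eq_zero] at h3; omega
    · rw [abs_eq_zero] at h3; omega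
  -- The meeting point of `l` and `m` has a nonzero integral position `t` on `l`. The resulting
  -- inequality fails for `0 < b' < b`, whatever the sign of `a'`.
  have k3 : |b' - a' * b| ≤ |b'| * |a' - 1| := by
    rw [← k2]
    exact le_mul_of_one_le_left (abs_nonneg _) (Int.one_le_abs ht0)
  rw [abs_of_pos h0] at k3
  rcases lt_or_gt_of_ne ha' with h4 | h4
  · rw [abs_of_nonpos (by omega : a' - 1 ≤ 0), abs_of_nonneg (by nlinarith)] at k3
    nlinarith
  · rw [abs_of_nonneg (by omega : 0 ≤ a' - 1), abs_of_nonpos (by nlinarith)] at k3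
    nlinarith

/-- A line at distance one from the origin on the first axis is at distance at most two on the
second. -/
theorem exists_right_le_two (h : IsMinFrame r R μ j k O e f) (hR : IsTightArrangement r R)
    {l : Finset (ℤ × ℤ)} (hl : l ∈ R) (hlj : l ≠ j) (hlk : l ≠ k)
    (hla : framePoint O e f 1 0 ∈ l) :
    ∃ b : ℤ, (b = 1 ∨ b = -1 ∨ b = 2 ∨ b = -2) ∧ framePoint O e f 0 b ∈ k ∧
      framePoint O e f 0 b ∈ l := by
  -- For `b ≥ 3` the positions `1` and `2` on the second axis would both be free. The lower bound
  -- follows by reversing `f`.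
  have main : ∀ f', IsMinFrame r R μ j k O e f' → framePoint O e f' 1 0 ∈ l → ∀ b : ℤ,
      framePoint O e f' 0 b ∈ k → framePoint O e f' 0 b ∈ l → b ≤ 2 := by
    intro f' h hla b hbk hbl
    by_contra! hb
    have h1 : framePoint O e f' 0 1 ∈ k := by
      rw [framePoint_right] at hbk ⊢
      exact h.right_seg.between (a := 0) (by simpa using h.origin_right) hbk (by omega) (by omega)
    have h2 : framePoint O e f' 0 2 ∈ k := by
      rw [framePoint_right] at hbk ⊢
      exact h.right_seg.between (a := 0) (by simpa using h.origin_right) hbk (by omega) (by omega)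
    obtain ⟨m, hm, hmk, hm1 | hm2⟩ := hR.exists_mem_or h.right_mem h1 h2 (fun h0 => by
      have := (framePoint_inj h.cross_ne h0).2
      omega)
    · exact h.notMem_of_lt hR hl hlj hlk hla hbl hm hmk (by omega) (by omega) hm1
    · exact h.notMem_of_lt hR hl hlj hlk hla hbl hm hmk (by omega) (by omega) hm2
  obtain ⟨b, hb, hbk, hbl⟩ := h.exists_right hR hl hlj hlk
  have u1 := main f h hla b hbk hbl
  have u2 := main (-f) h.neg_right (by rw [framePoint_neg_right]; simpa using hla) (-b)
    (by rw [framePoint_neg_right]; simpa using hbk) (by rw [framePoint_neg_right]; simpa using hbl)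
  exact ⟨b, by omega, hbk, hbl⟩

end IsMinFrame

/-! ### Chains of tangents to a parabola -/

/-- The members `g i` for `a ≤ i ≤ b` are tangent to a common parabola: in the frame
`(O, e, f)`, the point of `g i` at position `t` is `(i + t, i * t)`. -/
structure IsParabolicChain (r : ℕ) (R : Finset (Finset (ℤ × ℤ))) (μ : ℤ) (O e f : ℤ × ℤ)
    (g : ℤ → Finset (ℤ × ℤ)) (a b : ℤ) : Prop where
  bound : IsCrossBound r R μ
  abs_cross : |cross e f| = μ
  mem : ∀ i, a ≤ i → i ≤ b → g i ∈ R
  seg : ∀ i, a ≤ i → i ≤ b → SegOn r (g i) (framePoint O e f i 0) (e + i • f)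

theorem framePoint_tangent (O e f : ℤ × ℤ) (i t : ℤ) :
    framePoint O e f i 0 + t • (e + i • f) = framePoint O e f (i + t) (i * t) := by
  ext <;> simp [framePoint] <;> ring

namespace IsParabolicChain

variable {r : ℕ} {R : Finset (Finset (ℤ × ℤ))} {μ : ℤ} {O e f : ℤ × ℤ}
  {g : ℤ → Finset (ℤ × ℤ)} {a b : ℤ}

theorem cross_ne (h : IsParabolicChain r R μ O e f g a b) : cross e f ≠ 0 := by
  have := h.bound.pos
  rw [← h.abs_cross] at this
  exact abs_pos.mp this

/-- The affine symmetries of the parabola act on its tangents by translating the parameter. The new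
origin `(2s, s²)` is the point of tangency of tangent `s`, so any tangent can be made tangent `0`.
-/
theorem shift (h : IsParabolicChain r R μ O e f g a b) (s : ℤ) :
    IsParabolicChain r R μ (framePoint O e f (2 * s) (s * s)) (e + s • f) f (fun i => g (i + s))
      (a - s) (b - s) where
  bound := h.bound
  abs_cross := by
    rw [← h.abs_cross]
    congr 1
    simp [cross]
    ring
  mem i h1 h2 := h.mem _ (by omega) (by omega)
  seg i h1 h2 := by
    have := (h.seg (i + s) (by omega) (by omega)).shift s
    convert this using 1
    · ext <;> simp [framePoint] <;> ring
    · ext <;> simp <;> ring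

theorem framePoint_shift (O e f : ℤ × ℤ) (s x y : ℤ) :
    framePoint (framePoint O e f (2 * s) (s * s)) (e + s • f) f x y =
      framePoint O e f (x + 2 * s) (y + s * x + s * s) := by
  ext <;> simp [framePoint] <;> ring

/-- Reflection in the axis of the parabola. -/
theorem reverse (h : IsParabolicChain r R μ O e f g a b) :
    IsParabolicChain r R μ O (-e) f (fun i => g (-i)) (-b) (-a) where
  bound := h.bound
  abs_cross := by rw [cross_neg_left, abs_neg, h.abs_cross]
  mem i h1 h2 := h.mem _ (by omega) (by omega)
  seg i h1 h2 := by
    have := (h.seg (-i) (by omega) (by omega)).neg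
    convert this using 1
    · rw [framePoint_neg_left]
    · ext <;> simp <;> ring

theorem mono (h : IsParabolicChain r R μ O e f g a b) {a' b' : ℤ} (ha : a ≤ a') (hb : b' ≤ b) :
    IsParabolicChain r R μ O e f g a' b' :=
  ⟨h.bound, h.abs_cross, fun i h1 h2 => h.mem i (by omega) (by omega),
    fun i h1 h2 => h.seg i (by omega) (by omega)⟩

theorem extend (h : IsParabolicChain r R μ O e f g a b) {n : Finset (ℤ × ℤ)} (hn : n ∈ R)
    (hs : SegOn r n (framePoint O e f (b + 1) 0) (e + (b + 1) • f)) :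
    IsParabolicChain r R μ O e f (Function.update g (b + 1) n) a (b + 1) where
  bound := h.bound
  abs_cross := h.abs_cross
  mem i h1 h2 := by
    rcases eq_or_ne i (b + 1) with rfl | hi
    · simpa using hn
    · rw [Function.update_of_ne hi]
      exact h.mem i h1 (by omega)
  seg i h1 h2 := by
    rcases eq_or_ne i (b + 1) with rfl | hi
    · simpa using hs
    · rw [Function.update_of_ne hi]
      exact h.seg i h1 (by omega)

theorem ne (h : IsParabolicChain r R μ O e f g a b) (hr : 2 ≤ r) {i j : ℤ} (hi : a ≤ i) (hi' : i ≤ b)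
    (hj : a ≤ j) (hj' : j ≤ b) (hij : i ≠ j) : g i ≠ g j := by
  intro he
  have h1 := h.seg i hi hi'
  rw [he] at h1
  have h2 := h1.cross_eq_zero (h.seg j hj hj') hr
  have h3 : (j - i) * cross e f = 0 := by
    rw [← h2]
    simp [cross]
    ring
  rcases mul_eq_zero.mp h3 with h4 | h4
  · omega
  · exact h.cross_ne h4

theorem exists_eq (h : IsParabolicChain r R μ O e f g a b) {i x y : ℤ} (hi : a ≤ i) (hi' : i ≤ b)
    (hx : framePoint O e f x y ∈ g i) : ∃ t, x = i + t ∧ y = i * t := by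
  obtain ⟨t, ht⟩ := (h.seg i hi hi').exists_eq hx
  rw [framePoint_tangent] at ht
  exact ⟨t, framePoint_inj h.cross_ne ht⟩

theorem exists_hit (h : IsParabolicChain r R μ O e f g a b) {L : Finset (Finset (ℤ × ℤ))}
    (hL : IsArrangement r L) (hRL : R ⊆ L) {m : Finset (ℤ × ℤ)} (hm : m ∈ L) {i : ℤ} (hi : a ≤ i)
    (hi' : i ≤ b) (hmi : m ≠ g i) :
    ∃ t, framePoint O e f (i + t) (i * t) ∈ g i ∧ framePoint O e f (i + t) (i * t) ∈ m := by
  obtain ⟨t, h1, h2⟩ := hL.exists_mem (hRL (h.mem i hi hi')) hm hmi.symm (h.seg i hi hi')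
  rw [framePoint_tangent] at h1 h2
  exact ⟨t, h1, h2⟩

/-- The common point of tangents `i` and `j` is at position `j` on the former and `i` on the latter;
since the two progressions do meet, it belongs to both. -/
theorem meet_mem (h : IsParabolicChain r R μ O e f g a b) (hR : IsTightArrangement r R) {i j : ℤ}
    (hi : a ≤ i) (hi' : i ≤ b) (hj : a ≤ j) (hj' : j ≤ b) (hij : i ≠ j) :
    framePoint O e f (i + j) (i * j) ∈ g i := by
  obtain ⟨t, h1, h2⟩ := h.exists_hit hR.toIsArrangement subset_rfl (h.mem j hj hj') hi hi'
    (h.ne hR.two_le hj hj' hi hi' hij.symm)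
  obtain ⟨s, h3, h4⟩ := h.exists_eq hj hj' h2
  have : (j - i) * (t - j) = 0 := by linear_combination j * h3 - h4
  rcases mul_eq_zero.mp this with h5 | h5
  · omega
  · rwa [show t = j by omega] at h1

theorem notMem (h : IsParabolicChain r R μ O e f g a b) (hR : IsTightArrangement r R) {m : Finset (ℤ × ℤ)}
    (hm : m ∈ R) {i j : ℤ} (hi : a ≤ i) (hi' : i ≤ b) (hj : a ≤ j) (hj' : j ≤ b) (hij : i ≠ j)
    (hmi : m ≠ g i) (hmj : m ≠ g j) : framePoint O e f (i + j) (i * j) ∉ m := by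
  have h1 := h.meet_mem hR hi hi' hj hj' hij
  have h2 := h.meet_mem hR hj hj' hi hi' hij.symm
  rw [add_comm j i, mul_comm j i] at h2
  exact hR.simple _ (h.mem i hi hi') _ (h.mem j hj hj') m hm (h.ne hR.two_le hi hi' hj hj' hij)
    hmi.symm hmj.symm _ h1 h2

/-- The point of tangency on an inner line of a chain lies on no other line. -/
theorem origin_notMem (h : IsParabolicChain r R μ O e f g (-1) 1) (hR : IsTightArrangement r R)
    {n : Finset (ℤ × ℤ)} (hn : n ∈ R) (hn0 : n ≠ g 0) : framePoint O e f 0 0 ∉ n := by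
  intro h0
  have hA := hR.toIsArrangement
  have hn1 : n ≠ g 1 := by
    rintro rfl
    obtain ⟨t, h1, h2⟩ := h.exists_eq (by omega) (by omega) h0
    omega
  have hn2 : n ≠ g (-1) := by
    rintro rfl
    obtain ⟨t, h1, h2⟩ := h.exists_eq (by omega) (by omega) h0
    omega
  obtain ⟨t, -, ht⟩ := h.exists_hit hA subset_rfl hn (i := 1) (by omega) (by omega) hn1
  obtain ⟨s, -, hs⟩ := h.exists_hit hA subset_rfl hn (i := -1) (by omega) (by omega) hn2
  obtain ⟨p, d, hd⟩ := hR.seg n hn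
  have hc := hd.collinear h.cross_ne h0 ht hs
  have c1 : ¬ (t = 0) := by
    rintro rfl
    exact h.notMem hR hn (i := 1) (j := 0) (by omega) (by omega) (by omega) (by omega) (by omega)
      hn1 hn0 (by simpa using ht)
  have c2 : ¬ (t = -1) := by
    rintro rfl
    exact h.notMem hR hn (i := 1) (j := -1) (by omega) (by omega) (by omega) (by omega) (by omega)
      hn1 hn2 (by simpa using ht)
  -- So `2 t + 1` divides `t`, which only `t = 0` and `t = -1` allow. These are the crossings of
  -- tangent `1` with tangents `0` and `-1`, excluded by `c1` and `c2`.
  have hc' : t = s * (2 * t + 1) := by linarith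
  have hs0 : s ≠ 0 := by
    rintro rfl
    omega
  have h3 : |2 * t + 1| ≤ |t| := by
    calc |2 * t + 1| ≤ |s| * |2 * t + 1| :=
          le_mul_of_one_le_left (abs_nonneg _) (Int.one_le_abs hs0)
      _ = |t| := by rw [← abs_mul, ← hc']
  rcases abs_cases (2 * t + 1) with ⟨h4, h6⟩ | ⟨h4, h6⟩ <;>
    rcases abs_cases t with ⟨h5, h7⟩ | ⟨h5, h7⟩ <;> omega

/-- No line through the point of tangency at the end of a chain of three has the direction of the
axis of the parabola. -/
theorem not_segOn_axis (h : IsParabolicChain r R μ O e f g (-2) 0) (hR : IsTightArrangement r R)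
    {n : Finset (ℤ × ℤ)} (hn : n ∈ R) (hO : O ∈ n) (hs : SegOn r n O f) : False := by
  have hA := hR.toIsArrangement
  have hef := h.cross_ne
  have hcoord : ∀ x y, framePoint O e f x y ∈ n → x = 0 := by
    intro x y hxy
    obtain ⟨t, ht⟩ := hs.exists_eq hxy
    exact (framePoint_inj (x' := 0) (y' := t) hef (by rw [ht]; simp [framePoint])).1
  have hne : ∀ i, -2 ≤ i → i ≤ 0 → n ≠ g i := by
    rintro i hi hi' rfl
    have h1 := h.seg i hi hi'
    have h2 := hs.cross_eq_zero h1 hR.two_le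
    have : cross e f = 0 := by
      rw [← neg_eq_zero, ← h2]
      simp [cross]
      ring
    exact hef this
  obtain ⟨t, -, ht⟩ := h.exists_hit hA subset_rfl hn (i := -1) (by omega) (by omega)
    (hne _ (by omega) (by omega))
  obtain ⟨u, -, hu⟩ := h.exists_hit hA subset_rfl hn (i := -2) (by omega) (by omega)
    (hne _ (by omega) (by omega))
  obtain rfl : t = 1 := by have := hcoord _ _ ht; omega
  obtain rfl : u = 2 := by have := hcoord _ _ hu; omega
  have hm : ∀ y : ℤ, -4 ≤ y → y ≤ -1 → framePoint O e f 0 y ∈ n := by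
    intro y h1 h2
    rw [IsMinFrame.framePoint_right]
    refine hs.between (a := -4) (c := 0) ?_ (by simpa using hO) h1 (by omega)
    rw [← IsMinFrame.framePoint_right O e]
    simpa using hu
  -- The line `n` is `x = 0`; it meets tangents `0`, `-1`, `-2` at heights `0`, `-1`, `-4`. One of
  -- the intermediate heights `-2`, `-3` is thus occupied by a further line `q`.
  obtain ⟨q, hq, hqn, hq'⟩ := hR.exists_mem_or hn (hm (-2) (by omega) (by omega))
    (hm (-3) (by omega) (by omega)) (fun h0 => by have := (framePoint_inj hef h0).2; omega)
  obtain ⟨k, hk, hqk⟩ : ∃ k : ℤ, (k = 2 ∨ k = 3) ∧ framePoint O e f 0 (-k) ∈ q := by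
    rcases hq' with hq' | hq'
    · exact ⟨2, by omega, hq'⟩
    · exact ⟨3, by omega, hq'⟩
  have hqi : ∀ i, -2 ≤ i → i ≤ 0 → q ≠ g i := by
    rintro i hi hi' rfl
    obtain ⟨t, h1, h2⟩ := h.exists_eq hi hi' hqk
    obtain rfl : t = -i := by omega
    have : i = -2 ∨ i = -1 ∨ i = 0 := by omega
    rcases this with rfl | rfl | rfl <;> omega
  obtain ⟨t0, -, ht0⟩ := h.exists_hit hA subset_rfl hq (i := 0) (by omega) (by omega)
    (hqi _ (by omega) (by omega))
  obtain ⟨t1, -, ht1⟩ := h.exists_hit hA subset_rfl hq (i := -1) (by omega) (by omega)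
    (hqi _ (by omega) (by omega))
  obtain ⟨t2, -, ht2⟩ := h.exists_hit hA subset_rfl hq (i := -2) (by omega) (by omega)
    (hqi _ (by omega) (by omega))
  have n01 : t0 ≠ -1 := by
    rintro rfl
    exact h.notMem hR hq (i := 0) (j := -1) (by omega) (by omega) (by omega) (by omega) (by omega)
      (hqi _ (by omega) (by omega)) (hqi _ (by omega) (by omega)) ht0
  have n02 : t0 ≠ -2 := by
    rintro rfl
    exact h.notMem hR hq (i := 0) (j := -2) (by omega) (by omega) (by omega) (by omega) (by omega)
      (hqi _ (by omega) (by omega)) (hqi _ (by omega) (by omega)) ht0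
  have n00 : t0 ≠ 0 := by
    rintro rfl
    have h1 := hA.mem_unique hq hn hqn hqk (hm _ (by omega) (by omega)) ht0
      (by simpa [framePoint] using hO)
    have := (framePoint_inj hef h1).2
    omega
  have n12 : t2 ≠ -1 := by
    rintro rfl
    exact h.notMem hR hq (i := -2) (j := -1) (by omega) (by omega) (by omega) (by omega) (by omega)
      (hqi _ (by omega) (by omega)) (hqi _ (by omega) (by omega)) ht2
  have n20 : t2 ≠ 0 := by
    rintro rfl
    exact h.notMem hR hq (i := -2) (j := 0) (by omega) (by omega) (by omega) (by omega) (by omega)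
      (hqi _ (by omega) (by omega)) (hqi _ (by omega) (by omega)) ht2
  obtain ⟨p, d, hd⟩ := hR.seg q hq
  have c1 := hd.collinear hef hqk ht0 ht1
  have c2 := hd.collinear hef hqk ht0 ht2
  have e1 : t1 * (t0 + k) = k * (t0 + 1) := by linarith
  have e2 : t2 * (2 * t0 + k) = k * (t0 + 2) := by linarith
  -- Integrality of the crossing of `q` with tangent `-1` leaves finitely many `t0`; those that
  -- avoid the crossings of the chain fail on tangent `-2`.
  have hdvd : t0 + k ∣ k * (k - 1) := ⟨k - t1, by linarith⟩
  have hle := Int.le_of_dvd (by rcases hk with rfl | rfl <;> norm_num) hdvd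
  have hle' := Int.le_of_dvd (by rcases hk with rfl | rfl <;> norm_num) (neg_dvd.mpr hdvd)
  have hlo : -9 ≤ t0 := by rcases hk with rfl | rfl <;> omega
  have hhi : t0 ≤ 3 := by rcases hk with rfl | rfl <;> omega
  rcases hk with rfl | rfl <;> interval_cases t0 <;> omega

end IsParabolicChain

/-- A line adjacent to the last one on the last but one line of a chain continues the chain. -/
theorem IsParabolicChain.segOn_next {r : ℕ} {R : Finset (Finset (ℤ × ℤ))} {μ : ℤ} {O e f : ℤ × ℤ}
    {g : ℤ → Finset (ℤ × ℤ)} (h : IsParabolicChain r R μ O e f g (-2) 0)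
    (hR : IsTightArrangement r R) {n : Finset (ℤ × ℤ)} (hn : n ∈ R) (hn1 : n ≠ g (-1))
    (hnp : framePoint O e f 0 (-1) ∈ n) : SegOn r n (framePoint O e f 1 0) (e + (1 : ℤ) • f) := by
  have hef := h.cross_ne
  have hn0 : n ≠ g 0 := by
    rintro rfl
    obtain ⟨t, h1, h2⟩ := h.exists_eq (by omega) (by omega) hnp
    omega
  have hn2 : n ≠ g (-2) := by
    rintro rfl
    obtain ⟨t, h1, h2⟩ := h.exists_eq (by omega) (by omega) hnp
    omega
  -- Two consecutive tangents again have determinant `μ`, so they form a minimal frame at their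
  -- common point, and `n` is at distance one from it on tangent `-1`.
  have hF : IsMinFrame r R μ (g (-1)) (g 0) (framePoint O e f (-1) 0) (e - f) e := by
    refine ⟨h.bound, h.mem _ (by omega) (by omega), h.mem _ (by omega) (by omega), ?_, ?_, ?_, ?_,
      ?_⟩
    · have := h.seg (-1) (by omega) (by omega)
      rwa [neg_smul, one_smul, ← sub_eq_add_neg] at this
    · have := (h.seg 0 (by omega) (by omega)).shift (-1)
      convert this using 1
      · simp [framePoint]
      · simp
    · exact h.meet_mem hR (i := -1) (j := 0) (by omega) (by omega) (by omega) (by omega) (by omega)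
    · exact h.meet_mem hR (i := 0) (j := -1) (by omega) (by omega) (by omega) (by omega) (by omega)
    · rw [← h.abs_cross]
      congr 1
      simp [cross]
      ring
  have hpt : ∀ x y, framePoint (framePoint O e f (-1) 0) (e - f) e x y =
      framePoint O e f (x + y - 1) (-x) := by
    intro x y
    ext <;> simp [framePoint] <;> ring
  have hn' : framePoint (framePoint O e f (-1) 0) (e - f) e 1 0 ∈ n := by
    rw [hpt]
    exact hnp
  obtain ⟨b, hb, -, hbn⟩ := hF.exists_right_le_two hR hn hn1 hn0 hn'
  have hs := hF.segOn_sub hR hn hn1 hn0 hn' hbn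
  rw [hpt] at hs hbn
  -- The second intercepts are `(0, 0)`, `(-2, 0)`, `(1, 0)` and `(-3, 0)` in the old frame. They
  -- give an axis-parallel line, three concurrent lines, the desired tangent, and a line meeting
  -- tangent `-2` at no integral position.
  rcases hb with rfl | rfl | rfl | rfl
  · exfalso
    have hO : O ∈ n := by simpa [framePoint] using hbn
    refine h.not_segOn_axis hR hn hO ?_
    have := (hs.rebase hO).neg
    convert this using 1
    simp
  · have := h.notMem hR hn (i := -2) (j := 0) (by omega) (by omega) (by omega) (by omega)
      (by omega) hn2 hn0
    norm_num at hbn this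
    exact absurd hbn this
  · have hx : e + (1 : ℤ) • f = -(e - f - (2 : ℤ) • e) := by
      ext <;> simp <;> ring
    norm_num at hbn
    rw [hx]
    exact (hs.rebase hbn).neg
  · exfalso
    obtain ⟨t, -, ht⟩ := h.exists_hit hR.toIsArrangement subset_rfl hn (i := -2) (by omega)
      (by omega) hn2
    have := hs.collinear hef hnp hbn ht
    omega

/-! ### Three tangents from a line next to the origin of a minimal frame -/

namespace IsMinFrame

variable {r : ℕ} {R : Finset (Finset (ℤ × ℤ))} {μ : ℤ} {j k : Finset (ℤ × ℤ)}
  {O e f : ℤ × ℤ}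

/-- Three lines forming a triangle with sides `1`, `2`, `1` form a chain. -/
theorem exists_chain (h : IsMinFrame r R μ j k O e f) (hR : IsTightArrangement r R)
    {l : Finset (ℤ × ℤ)} (hl : l ∈ R) (hlj : l ≠ j) (hlk : l ≠ k)
    (hla : framePoint O e f 1 0 ∈ l) (hlb : framePoint O e f 0 2 ∈ l) :
    ∃ O e f g, IsParabolicChain r R μ O e f g 0 2 := by
  have hs := (h.segOn_sub hR hl hlj hlk hla hlb).rebase hlb
  -- The side of length two becomes tangent `0`, touching the parabola at its midpoint `(0, 1)`.
  have key : IsParabolicChain r R μ (framePoint O e f 0 1) f (f - e)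
      (fun i => if i = -1 then j else if i = 0 then k else l) (-1) 1 := by
    refine ⟨h.bound, ?_, ?_, ?_⟩
    · rw [← h.abs_cross]
      congr 1
      simp [cross]
      ring
    · intro i _ _
      split_ifs
      exacts [h.left_mem, h.right_mem, hl]
    · intro i h1 h2
      obtain rfl | rfl | rfl : i = -1 ∨ i = 0 ∨ i = 1 := by omega
      · change SegOn r j _ _
        convert h.left_seg using 1
        · simp [framePoint]
        · simp
      · change SegOn r k _ _
        convert h.right_seg.shift 1 using 1
        · simp [framePoint]
        · simp
      · change SegOn r l _ _
        convert hs.neg using 1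
        · simp [framePoint, add_assoc, two_mul]
        · simp only [one_smul, neg_sub, two_smul]
          abel
  exact ⟨_, _, _, _, key.shift (-1)⟩

theorem exists_chain' (h : IsMinFrame r R μ j k O e f) (hR : IsTightArrangement r R)
    {l : Finset (ℤ × ℤ)} (hl : l ∈ R) (hlj : l ≠ j) (hlk : l ≠ k)
    (hla : framePoint O e f 1 0 ∈ l) {b : ℤ} (hb : b = 2 ∨ b = -2)
    (hlb : framePoint O e f 0 b ∈ l) : ∃ O e f g, IsParabolicChain r R μ O e f g 0 2 := by
  rcases hb with rfl | rfl
  · exact h.exists_chain hR hl hlj hlk hla hlb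
  · exact h.neg_right.exists_chain hR hl hlj hlk (by rw [framePoint_neg_right]; simpa using hla)
      (by rw [framePoint_neg_right]; simpa using hlb)

end IsMinFrame

/-- A minimal frame with a further line through the points at distance `1` on both axes. -/
structure IsUnitTriangle (r : ℕ) (R : Finset (Finset (ℤ × ℤ))) (μ : ℤ) (j k l : Finset (ℤ × ℤ))
    (O e f : ℤ × ℤ) : Prop where
  frame : IsMinFrame r R μ j k O e f
  mem : l ∈ R
  ne_left : l ≠ j
  ne_right : l ≠ k
  left_mem : framePoint O e f 1 0 ∈ j
  left_mem' : framePoint O e f 1 0 ∈ l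
  right_mem : framePoint O e f 0 1 ∈ k
  right_mem' : framePoint O e f 0 1 ∈ l

namespace IsUnitTriangle

variable {r : ℕ} {R : Finset (Finset (ℤ × ℤ))} {μ : ℤ} {j k l n : Finset (ℤ × ℤ)}
  {O e f : ℤ × ℤ}

theorem segOn (h : IsUnitTriangle r R μ j k l O e f) (hR : IsTightArrangement r R) :
    SegOn r l (framePoint O e f 1 0) (e - f) := by
  simpa using h.frame.segOn_sub hR h.mem h.ne_left h.ne_right h.left_mem' h.right_mem'

theorem swap (h : IsUnitTriangle r R μ j k l O e f) : IsUnitTriangle r R μ k j l O f e where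
  frame := h.frame.swap
  mem := h.mem
  ne_left := h.ne_right
  ne_right := h.ne_left
  left_mem := by rw [framePoint_swap]; exact h.right_mem
  left_mem' := by rw [framePoint_swap]; exact h.right_mem'
  right_mem := by rw [framePoint_swap]; exact h.left_mem
  right_mem' := by rw [framePoint_swap]; exact h.left_mem'

theorem framePoint_rotate (O e f : ℤ × ℤ) (x y : ℤ) :
    framePoint (framePoint O e f 1 0) (-e) (f - e) x y = framePoint O e f (1 - x - y) y := by
  ext <;> simp [framePoint] <;> ring

/-- All three pairs of sides have determinant `±μ`, so every vertex can serve as origin. With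
`swap`, this gives all symmetries of the triangle. -/
theorem rotate (h : IsUnitTriangle r R μ j k l O e f) (hR : IsTightArrangement r R) :
    IsUnitTriangle r R μ j l k (framePoint O e f 1 0) (-e) (f - e) where
  frame := by
    refine ⟨h.frame.bound, h.frame.left_mem, h.mem, (h.frame.left_seg.rebase h.left_mem).neg, ?_,
      h.left_mem, h.left_mem', ?_⟩
    · have := (h.segOn hR).neg
      rwa [neg_sub] at this
    · rw [← h.frame.abs_cross, ← abs_neg]
      congr 1
      simp [cross]
      ring
  mem := h.frame.right_mem
  ne_left := (h.frame.ne hR).symm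
  ne_right := h.ne_right.symm
  left_mem := by rw [framePoint_rotate]; simpa [framePoint] using h.frame.origin_left
  left_mem' := by rw [framePoint_rotate]; simpa [framePoint] using h.frame.origin_right
  right_mem := by rw [framePoint_rotate]; simpa using h.right_mem'
  right_mem' := by rw [framePoint_rotate]; simpa using h.right_mem

/-- In the frame at `(1, 0)` with axes `j` and `l`, the line `n` has first intercept `1`. A second
intercept `1` makes it parallel to `k`, `-1` sends it through the vertex of `k` and `l`, and `±2`
gives a chain. -/
theorem exists_chain_of_mem (h : IsUnitTriangle r R μ j k l O e f) (hR : IsTightArrangement r R)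
    (hn : n ∈ R) (hnj : n ≠ j) (hp : framePoint O e f 2 0 ∈ n) :
    ∃ O e f g, IsParabolicChain r R μ O e f g 0 2 := by
  have hef := h.frame.cross_ne
  have hnk : n ≠ k := by
    rintro rfl
    obtain ⟨t, ht⟩ := h.frame.right_seg.exists_eq hp
    rw [← IsMinFrame.framePoint_right O e] at ht
    have := (framePoint_inj hef ht).1
    omega
  have hnl : n ≠ l := by
    rintro rfl
    obtain ⟨t, ht⟩ := (h.segOn hR).exists_eq hp
    have : framePoint O e f 2 0 = framePoint O e f (1 + t) (-t) := by
      rw [ht]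
      ext <;> simp [framePoint] <;> ring
    have := framePoint_inj hef this
    omega
  have hF : IsMinFrame r R μ j l (framePoint O e f 1 0) e (e - f) := by
    have := (h.rotate hR).frame.neg_left.neg_right
    simpa using this
  have hpt : ∀ x y, framePoint (framePoint O e f 1 0) e (e - f) x y =
      framePoint O e f (1 + x + y) (-y) := by
    intro x y
    ext <;> simp [framePoint] <;> ring
  have hp' : framePoint (framePoint O e f 1 0) e (e - f) 1 0 ∈ n := by
    rw [hpt]
    simpa using hp
  obtain ⟨b, hb, -, hbn⟩ := hF.exists_right_le_two hR hn hnj hnl hp'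
  have hs := hF.segOn_sub hR hn hnj hnl hp' hbn
  rcases hb with rfl | rfl | hb
  · exfalso
    refine hR.cross_ne n hn k h.frame.right_mem hnk _ _ _ _ hs h.frame.right_seg ?_
    simp [cross]
    ring
  · rw [hpt] at hbn
    exact absurd hbn (hR.simple k h.frame.right_mem l h.mem n hn h.ne_right.symm hnk.symm hnl.symm
      _ h.right_mem h.right_mem')
  · exact hF.exists_chain' hR hn hnj hnl hp' hb hbn

/-- A unit triangle with a line crossing the first side at position `3`, and no line at distance
one beyond the vertices, is impossible. -/
theorem false_of_mem (hR : IsTightArrangement r R)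
    (hno : ¬ ∃ O e f g, IsParabolicChain r R μ O e f g 0 2)
    (h : IsUnitTriangle r R μ j k l O e f) (hn : n ∈ R) (hnj : n ≠ j)
    (hp : framePoint O e f 3 0 ∈ n) : False := by
  have hef := h.frame.cross_ne
  have hA := hR.toIsArrangement
  -- Without a chain, the points next to the vertices on the prolonged sides are all free.
  have hk2 : ∀ m ∈ R, m ≠ k → framePoint O e f 0 2 ∉ m := by
    intro m hm hmk hmp
    exact hno (h.swap.exists_chain_of_mem hR hm hmk (by rwa [framePoint_swap]))
  have hk1 : ∀ m ∈ R, m ≠ k → framePoint O e f 0 (-1) ∉ m := by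
    intro m hm hmk hmp
    exact hno ((h.swap.rotate hR).exists_chain_of_mem hR hm hmk
      (by rw [framePoint_rotate, framePoint_swap]; simpa using hmp))
  have hj2 : ∀ m ∈ R, m ≠ j → framePoint O e f 2 0 ∉ m := by
    intro m hm hmk hmp
    exact hno (h.exists_chain_of_mem hR hm hmk hmp)
  have hl1 : ∀ m ∈ R, m ≠ l → framePoint O e f (-1) 2 ∉ m := by
    intro m hm hmk hmp
    exact hno ((h.rotate hR).swap.exists_chain_of_mem hR hm hmk
      (by rw [framePoint_swap, framePoint_rotate]; simpa using hmp))
  have hl2 : ∀ m ∈ R, m ≠ l → framePoint O e f 2 (-1) ∉ m := by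
    intro m hm hmk hmp
    exact hno (((h.rotate hR).swap.rotate hR).exists_chain_of_mem hR hm hmk
      (by rw [framePoint_rotate, framePoint_swap, framePoint_rotate]; simpa using hmp))
  have hjl : ∀ m ∈ R, m ≠ j → m ≠ l → framePoint O e f 1 0 ∉ m := fun m hm h1 h2 =>
    hR.simple j h.frame.left_mem l h.mem m hm h.ne_left.symm h1.symm h2.symm _ h.left_mem
      h.left_mem'
  have hkl : ∀ m ∈ R, m ≠ k → m ≠ l → framePoint O e f 0 1 ∉ m := fun m hm h1 h2 =>
    hR.simple k h.frame.right_mem l h.mem m hm h.ne_right.symm h1.symm h2.symm _ h.right_mem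
      h.right_mem'
  have hk_coord : ∀ x y, framePoint O e f x y ∈ k → x = 0 := by
    intro x y hxy
    obtain ⟨t, ht⟩ := h.frame.right_seg.exists_eq hxy
    rw [← IsMinFrame.framePoint_right O e] at ht
    exact (framePoint_inj hef ht).1
  have hj_coord : ∀ x y, framePoint O e f x y ∈ j → y = 0 := by
    intro x y hxy
    obtain ⟨t, ht⟩ := h.frame.left_seg.exists_eq hxy
    rw [← IsMinFrame.framePoint_left O e f] at ht
    exact (framePoint_inj hef ht).2
  have hl_pt : ∀ t : ℤ, framePoint O e f 1 0 + t • (e - f) = framePoint O e f (1 + t) (-t) := by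
    intro t
    ext <;> simp [framePoint] <;> ring
  have hl_coord : ∀ x y, framePoint O e f x y ∈ l → x = 1 - y := by
    intro x y hxy
    obtain ⟨t, ht⟩ := (h.segOn hR).exists_eq hxy
    rw [hl_pt] at ht
    have := framePoint_inj hef ht
    omega
  have hnk : n ≠ k := by
    rintro rfl
    have := hk_coord _ _ hp
    omega
  have hnl : n ≠ l := by
    rintro rfl
    have := hl_coord _ _ hp
    omega
  obtain ⟨b, hb0, hbk, hbn⟩ := h.frame.exists_right hR hn hnj hnk
  obtain ⟨t, htl, htn⟩ := hA.exists_mem h.mem hn hnl.symm (h.segOn hR)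
  rw [hl_pt] at htl htn
  obtain ⟨p, d, hd⟩ := hR.seg n hn
  have hc := hd.collinear hef hp hbn htn
  have t0 : t ≠ 0 := by
    rintro rfl
    exact hjl n hn hnj hnl (by simpa using htn)
  have t1 : t ≠ -1 := by
    rintro rfl
    exact hkl n hn hnk hnl (by simpa using htn)
  have t2 : t ≠ 1 := by
    rintro rfl
    exact hl2 n hn hnl (by simpa using htn)
  have b2 : b ≠ 2 := by
    rintro rfl
    exact hk2 n hn hnk hbn
  -- Collinearity reads `(t - 2) (b - 3) = 6`; the free points and vertices exclude all solutions
  -- with `t < 3`. So `k` reaches position `4`, and since position `2` is free, another line `m`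
  -- passes through position `3`.
  have hdvd : t - 2 ∣ 6 := ⟨b - 3, by linarith⟩
  have hle := Int.le_of_dvd (by norm_num) hdvd
  have hle' := Int.le_of_dvd (by norm_num) (neg_dvd.mpr hdvd)
  have hbt : 4 ≤ b ∧ 3 ≤ t := by
    have : -4 ≤ t := by omega
    have : t ≤ 8 := by omega
    clear hdvd
    interval_cases t <;> omega
  have hk_mem : ∀ y : ℤ, 0 ≤ y → y ≤ 4 → framePoint O e f 0 y ∈ k := by
    intro y h1 h2
    rw [IsMinFrame.framePoint_right] at hbk ⊢
    exact h.frame.right_seg.between (a := 0) (by simpa using h.frame.origin_right) hbk h1 (by omega)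
  obtain ⟨m, hm, hmk, hm'⟩ := hR.exists_mem_or h.frame.right_mem (hk_mem 2 (by omega) (by omega))
    (hk_mem 3 (by omega) (by omega)) (fun h0 => by have := (framePoint_inj hef h0).2; omega)
  have hmp := hm'.resolve_left (hk2 m hm hmk)
  have hmj : m ≠ j := by
    rintro rfl
    have := hj_coord _ _ hmp
    omega
  have hml : m ≠ l := by
    rintro rfl
    have := hl_coord _ _ hmp
    omega
  have hmn : n ≠ m := by
    rintro rfl
    have := hA.mem_unique hn h.frame.right_mem hnk hbn hbk hmp (hk_mem 3 (by omega) (by omega))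
    have := (framePoint_inj hef this).2
    omega
  obtain ⟨a, ha0, haj, ham⟩ := h.frame.exists_left hR hm hmj hmk
  obtain ⟨s, hsl, hsm⟩ := hA.exists_mem h.mem hm hml.symm (h.segOn hR)
  rw [hl_pt] at hsl hsm
  obtain ⟨p', d', hd'⟩ := hR.seg m hm
  have hc' := hd'.collinear hef hmp ham hsm
  have s0 : s ≠ 0 := by
    rintro rfl
    exact hjl m hm hmj hml (by simpa using hsm)
  have s1 : s ≠ -1 := by
    rintro rfl
    exact hkl m hm hmk hml (by simpa using hsm)
  have s2 : s ≠ -2 := by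
    rintro rfl
    exact hl1 m hm hml (by simpa using hsm)
  have a2 : a ≠ 2 := by
    rintro rfl
    exact hj2 m hm hmj ham
  -- Likewise `(s + 3) (3 - a) = 6` leaves only `s ≤ -4`. Then `l` extends beyond both its vertices
  -- and has two free points, one too many.
  have hdvd' : s + 3 ∣ 6 := ⟨3 - a, by linarith⟩
  have gle := Int.le_of_dvd (by norm_num) hdvd'
  have gle' := Int.le_of_dvd (by norm_num) (neg_dvd.mpr hdvd')
  have hs : s ≤ -4 := by
    have : -9 ≤ s := by omega
    have : s ≤ 3 := by omega
    clear hdvd'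
    interval_cases s <;> omega
  have hl_mem : ∀ u : ℤ, -4 ≤ u → u ≤ 3 → framePoint O e f (1 + u) (-u) ∈ l := by
    intro u h1 h2
    rw [← hl_pt] at htl hsl ⊢
    exact (h.segOn hR).between hsl htl (by omega) (by omega)
  obtain ⟨q, hq, hql, hq' | hq'⟩ := hR.exists_mem_or h.mem (hl_mem 1 (by omega) (by omega))
    (hl_mem (-2) (by omega) (by omega)) (fun h0 => by have := (framePoint_inj hef h0).2; omega)
  · exact hl2 q hq hql (by simpa using hq')
  · exact hl1 q hq hql (by simpa using hq')

/-- Without a chain, positions `2` and `-1` on `j` are free, so `j` contains at most one of them. As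
`r ≥ 4`, it contains positions `2`, `3` or `-1`, `-2`, and the outer one is occupied. A rotation
reduces the second case to the first. -/
theorem exists_chain (h : IsUnitTriangle r R μ j k l O e f) (hR : IsTightArrangement r R)
    (hr : 4 ≤ r) : ∃ O e f g, IsParabolicChain r R μ O e f g 0 2 := by
  by_contra hno
  have hef := h.frame.cross_ne
  have hj2 : ∀ m ∈ R, m ≠ j → framePoint O e f 2 0 ∉ m := by
    intro m hm hmk hmp
    exact hno (h.exists_chain_of_mem hR hm hmk hmp)
  have hj1 : ∀ m ∈ R, m ≠ j → framePoint O e f (-1) 0 ∉ m := by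
    intro m hm hmk hmp
    exact hno ((h.rotate hR).exists_chain_of_mem hR hm hmk
      (by rw [framePoint_rotate]; simpa using hmp))
  obtain ⟨w, hw⟩ := h.frame.left_seg.exists_window
  simp only [← IsMinFrame.framePoint_left O e f] at hw
  have w0 := (hw 0).1 (by simpa [framePoint] using h.frame.origin_left)
  have w1 := (hw 1).1 h.left_mem
  have hw12 : ¬ (framePoint O e f 2 0 ∈ j ∧ framePoint O e f (-1) 0 ∈ j) := by
    rintro ⟨h1, h2⟩
    obtain ⟨q, hq, hqj, hq' | hq'⟩ := hR.exists_mem_or h.frame.left_mem h1 h2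
      (fun h0 => by have := (framePoint_inj hef h0).1; omega)
    · exact hj2 q hq hqj hq'
    · exact hj1 q hq hqj hq'
  rw [hw, hw] at hw12
  have hcase : (w ≤ 2 ∧ 3 < w + r) ∨ (w ≤ -2 ∧ -1 < w + r) := by omega
  rcases hcase with hcase | hcase
  · obtain ⟨q, hq, hqj, hq'⟩ := hR.exists_mem_or h.frame.left_mem ((hw 2).2 (by omega))
      ((hw 3).2 (by omega)) (fun h0 => by have := (framePoint_inj hef h0).1; omega)
    exact false_of_mem hR hno h hq hqj (hq'.resolve_left (hj2 q hq hqj))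
  · obtain ⟨q, hq, hqj, hq'⟩ := hR.exists_mem_or h.frame.left_mem ((hw (-1)).2 (by omega))
      ((hw (-2)).2 (by omega)) (fun h0 => by have := (framePoint_inj hef h0).1; omega)
    refine false_of_mem hR hno (h.rotate hR) hq hqj ?_
    rw [framePoint_rotate]
    simpa using hq'.resolve_left (hj1 q hq hqj)

end IsUnitTriangle

/-! ### Existence of a line next to the origin of some minimal frame -/

/-- `n` meets the axes at `(a, 0)` and `(0, b)`, at distance `|c|` from each other. -/
structure HasIntercepts (r : ℕ) (O e f : ℤ × ℤ) (n : Finset (ℤ × ℤ)) (a b c : ℤ) : Prop where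
  left_mem : framePoint O e f a 0 ∈ n
  right_mem : framePoint O e f 0 b ∈ n
  ne_zero : c ≠ 0
  le_left : |c| ≤ |a|
  le_right : |c| ≤ |b|
  seg : ∃ d, SegOn r n (framePoint O e f a 0) d ∧ c • d = a • e - b • f

namespace IsMinFrame

variable {r : ℕ} {R : Finset (Finset (ℤ × ℤ))} {μ : ℤ} {j k : Finset (ℤ × ℤ)}
  {O e f : ℤ × ℤ}

theorem intercepts_relation (h : IsMinFrame r R μ j k O e f) (hR : IsTightArrangement r R)
    {n n' : Finset (ℤ × ℤ)} (hn : n ∈ R) (hnj : n ≠ j) (hnk : n ≠ k) (hn' : n' ∈ R) (hnk' : n' ≠ k)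
    {a b c a' b' c' : ℤ} (ha : framePoint O e f a 0 ∈ j) (ha' : framePoint O e f a' 0 ∈ j)
    (hb : framePoint O e f 0 b ∈ k) (haa' : a ≠ a')
    (hi : HasIntercepts r O e f n a b c) (hi' : HasIntercepts r O e f n' a' b' c') :
    b ≠ b' ∧ ∃ t, t * (a * b' - a' * b) = c * b' * (a' - a) := by
  have hne : n ≠ n' := by
    rintro rfl
    have := hR.mem_unique hn h.left_mem hnj hi.left_mem ha hi'.left_mem ha'
    exact haa' (framePoint_inj h.cross_ne this).1
  constructor
  · rintro rfl
    exact hR.simple k h.right_mem n hn n' hn' hnk.symm hnk'.symm hne _ hb hi.right_mem hi'.right_mem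
  · obtain ⟨d, hd, hcd⟩ := hi.seg
    obtain ⟨d', hd', hcd'⟩ := hi'.seg
    obtain ⟨t, -, ht⟩ := hR.exists_mem hn hn' hne hd
    obtain ⟨t', ht'⟩ := hd'.exists_eq ht
    exact ⟨t, intercept_relation h.cross_ne hi'.ne_zero hcd hcd' ht'⟩

/-- It is impossible that both axes are entirely on the positive side of the origin and that no
line is adjacent to the origin on them. -/
theorem false_of_isolated (h : IsMinFrame r R μ j k O e f) (hR : IsTightArrangement r R)
    (hr : 4 ≤ r) (hj : ∀ t, framePoint O e f t 0 ∈ j ↔ 0 ≤ t ∧ t < r)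
    (hk : ∀ t, framePoint O e f 0 t ∈ k ↔ 0 ≤ t ∧ t < r)
    (hj1 : ∀ n ∈ R, n ≠ j → framePoint O e f 1 0 ∉ n)
    (hk1 : ∀ n ∈ R, n ≠ k → framePoint O e f 0 1 ∉ n) : False := by
  have hef := h.cross_ne
  have data : ∀ n ∈ R, n ≠ j → n ≠ k → ∃ a b c : ℤ, 2 ≤ a ∧ a < r ∧ 2 ≤ b ∧ b < r ∧
      HasIntercepts r O e f n a b c := by
    intro n hn hnj hnk
    obtain ⟨a, ha, haj, han⟩ := h.exists_left hR hn hnj hnk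
    obtain ⟨b, hb, hbk, hbn⟩ := h.exists_right hR hn hnj hnk
    obtain ⟨c, d, hd, hcd, hc, hca, hcb⟩ := h.exists_step hR hn hnj hnk ha han hbn
    have a1 : a ≠ 1 := by
      rintro rfl
      exact hj1 n hn hnj han
    have b1 : b ≠ 1 := by
      rintro rfl
      exact hk1 n hn hnk hbn
    have := (hj a).1 haj
    have := (hk b).1 hbk
    exact ⟨a, b, c, by omega, by omega, by omega, by omega, han, hbn, hc, hca, hcb, d, hd, hcd⟩
  -- Position `1` is the free point of each axis, so all positions from `2` on are occupied.
  have left : ∀ a : ℤ, 2 ≤ a → a < r → ∃ n ∈ R, n ≠ j ∧ n ≠ k ∧ ∃ b c : ℤ, 2 ≤ b ∧ b < r ∧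
      HasIntercepts r O e f n a b c := by
    intro a h1 h2
    obtain ⟨n, hn, hnj, hn'⟩ := hR.exists_mem_or h.left_mem ((hj 1).2 (by omega))
      ((hj a).2 (by omega)) (fun h0 => by have := (framePoint_inj hef h0).1; omega)
    have han := hn'.resolve_left (hj1 n hn hnj)
    have hnk : n ≠ k := by
      rintro rfl
      obtain ⟨t, ht⟩ := h.right_seg.exists_eq han
      rw [← IsMinFrame.framePoint_right O e] at ht
      have := (framePoint_inj hef ht).1
      omega
    obtain ⟨a', b, c, h3, h4, h5, h6, hi⟩ := data n hn hnj hnk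
    have := hR.mem_unique hn h.left_mem hnj han ((hj a).2 (by omega)) hi.left_mem
      ((hj a').2 (by omega))
    obtain rfl := (framePoint_inj hef this).1
    exact ⟨n, hn, hnj, hnk, b, c, h5, h6, hi⟩
  have right : ∀ b : ℤ, 2 ≤ b → b < r → ∃ n ∈ R, n ≠ j ∧ n ≠ k ∧ ∃ a c : ℤ, 2 ≤ a ∧ a < r ∧
      HasIntercepts r O e f n a b c := by
    intro b h1 h2
    obtain ⟨n, hn, hnk, hn'⟩ := hR.exists_mem_or h.right_mem ((hk 1).2 (by omega))
      ((hk b).2 (by omega)) (fun h0 => by have := (framePoint_inj hef h0).2; omega)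
    have hbn := hn'.resolve_left (hk1 n hn hnk)
    have hnj : n ≠ j := by
      rintro rfl
      obtain ⟨t, ht⟩ := h.left_seg.exists_eq hbn
      rw [← IsMinFrame.framePoint_left O e f] at ht
      have := (framePoint_inj hef ht).2
      omega
    obtain ⟨a, b', c, h3, h4, h5, h6, hi⟩ := data n hn hnj hnk
    have := hR.mem_unique hn h.right_mem hnk hbn ((hk b).2 (by omega)) hi.right_mem
      ((hk b').2 (by omega))
    obtain rfl := (framePoint_inj hef this).2
    exact ⟨n, hn, hnj, hnk, a, c, h3, h4, hi⟩
  have rel : ∀ n ∈ R, n ≠ j → n ≠ k → ∀ n' ∈ R, n' ≠ j → n' ≠ k → ∀ a b c a' b' c' : ℤ, 2 ≤ a →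
      a < r → 2 ≤ a' → a' < r → 2 ≤ b → b < r → a ≠ a' →
      HasIntercepts r O e f n a b c → HasIntercepts r O e f n' a' b' c' →
      b ≠ b' ∧ ∃ t, t * (a * b' - a' * b) = c * b' * (a' - a) := by
    intro n hn hnj hnk n' hn' hnj' hnk' a b c a' b' c' h1 h2 h3 h4 h5 h6 h7 hi hi'
    exact h.intercepts_relation hR hn hnj hnk hn' hnk' ((hj a).2 (by omega)) ((hj a').2 (by omega))
      ((hk b).2 (by omega)) h7 hi hi'
  obtain ⟨n₂, hn₂, hn₂j, hn₂k, b₂, c₂, hb₂, hb₂r, i₂⟩ := left 2 (by omega) (by omega)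
  obtain ⟨n₃, hn₃, hn₃j, hn₃k, b₃, c₃, hb₃, hb₃r, i₃⟩ := left 3 (by omega) (by omega)
  obtain ⟨m₂, hm₂, hm₂j, hm₂k, a₂, d₂, ha₂, ha₂r, k₂⟩ := right 2 (by omega) (by omega)
  obtain ⟨m₃, hm₃, hm₃j, hm₃k, a₃, d₃, ha₃, ha₃r, k₃⟩ := right 3 (by omega) (by omega)
  have bc₂ := abs_le.mp i₂.le_left
  have bc₃ := abs_le.mp i₃.le_left
  have bd₂ := abs_le.mp k₂.le_right
  have bd₃ := abs_le.mp k₃.le_right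
  rw [abs_of_pos (by norm_num : (0 : ℤ) < 2)] at bc₂ bd₂
  rw [abs_of_pos (by norm_num : (0 : ℤ) < 3)] at bc₃ bd₃
  have nz₂ := i₂.ne_zero
  have nz₃ := i₃.ne_zero
  -- Otherwise the lines with intercepts `(2, b₂)` and `(a₂, 2)` differ. Integrality of their
  -- crossing, with `|c₂|, |d₂| ≤ 2`, forces `a₂ = b₂ = 3`, and then `5` would divide `2 c₂`.
  obtain rfl : b₂ = 2 := by
    by_contra hb
    have hmn : ¬ a₂ = 2 := by
      rintro rfl
      have hnm : n₂ = m₂ := by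
        by_contra hnm
        exact hR.simple j h.left_mem n₂ hn₂ m₂ hm₂ hn₂j.symm hm₂j.symm hnm _
          ((hj 2).2 (by omega)) i₂.left_mem k₂.left_mem
      subst hnm
      have := hR.mem_unique hn₂ h.right_mem hn₂k i₂.right_mem ((hk _).2 (by omega)) k₂.right_mem
        ((hk _).2 (by omega))
      exact hb (framePoint_inj hef this).2
    obtain ⟨-, t, ht⟩ := rel n₂ hn₂ hn₂j hn₂k m₂ hm₂ hm₂j hm₂k _ _ _ _ _ _ (by omega) (by omega)
      (by omega) (by omega) (by omega) (by omega) (Ne.symm hmn) i₂ k₂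
    obtain ⟨-, u, hu⟩ := rel m₂ hm₂ hm₂j hm₂k n₂ hn₂ hn₂j hn₂k _ _ _ _ _ _ (by omega) (by omega)
      (by omega) (by omega) (by omega) (by omega) hmn k₂ i₂
    have h3a : 3 ≤ a₂ := by omega
    have h3b : 3 ≤ b₂ := by omega
    have hpos : 0 < a₂ * b₂ - 4 := by nlinarith
    have d1 : a₂ * b₂ - 4 ∣ c₂ * 2 * (a₂ - 2) := ⟨-t, by linarith⟩
    have d2 : a₂ * b₂ - 4 ∣ d₂ * 2 * (b₂ - 2) * 1 := by
      have : (u * (a₂ * b₂ - 4) : ℤ) = d₂ * b₂ * (2 - a₂) := by linarith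
      have h4 : a₂ * b₂ - 4 ∣ d₂ * b₂ * (a₂ - 2) := ⟨-u, by linarith⟩
      have h5 : d₂ * 2 * (b₂ - 2) * 1 = d₂ * (a₂ * b₂ - 4) - d₂ * b₂ * (a₂ - 2) := by ring
      rw [h5]
      exact dvd_sub (dvd_mul_left _ _) h4
    have hlt : b₂ < 4 := by
      have hne : c₂ * 2 * (a₂ - 2) ≠ 0 := by
        have : a₂ - 2 ≠ 0 := by omega
        positivity
      have := Int.le_of_dvd (abs_pos.mpr hne) ((dvd_abs _ _).mpr d1)
      rw [abs_mul, abs_mul, abs_of_pos (by omega : 0 < a₂ - 2), abs_two] at this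
      have hc : |c₂| ≤ 2 := abs_le.mpr bc₂
      nlinarith
    have hlt' : a₂ < 4 := by
      have hne : d₂ * 2 * (b₂ - 2) * 1 ≠ 0 := by
        have : b₂ - 2 ≠ 0 := by omega
        have := k₂.ne_zero
        positivity
      have := Int.le_of_dvd (abs_pos.mpr hne) ((dvd_abs _ _).mpr d2)
      rw [mul_one, abs_mul, abs_mul, abs_of_pos (by omega : 0 < b₂ - 2), abs_two] at this
      have hc : |d₂| ≤ 2 := abs_le.mpr bd₂
      nlinarith
    obtain rfl : a₂ = 3 := by omega
    obtain rfl : b₂ = 3 := by omega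
    omega
  obtain ⟨h23, t, ht⟩ := rel n₂ hn₂ hn₂j hn₂k n₃ hn₃ hn₃j hn₃k _ _ _ _ _ _ (by omega) (by omega)
      (by omega) (by omega) (by omega) (by omega) (by norm_num) i₂ i₃
  obtain ⟨-, u, hu⟩ := rel n₃ hn₃ hn₃j hn₃k n₂ hn₂ hn₂j hn₂k _ _ _ _ _ _ (by omega) (by omega)
      (by omega) (by omega) (by omega) (by omega) (by norm_num) i₃ i₂
  -- Crossing the line with intercepts `(2, 2)` makes `b₃ - 3` a divisor of `c₃`, where `0 < |c₃| ≤
  -- 3`.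
  have hb₃' : 4 ≤ b₃ ∧ b₃ ≤ 6 := by
    have hne : b₃ ≠ 3 := by
      rintro rfl
      omega
    have hd : b₃ - 3 ∣ c₃ := ⟨u, by linarith⟩
    have := Int.le_of_dvd (abs_pos.mpr nz₃) ((dvd_abs _ _).mpr hd)
    have : |c₃| ≤ 3 := abs_le.mpr bc₃
    omega
  have ha32 : a₃ ≠ 2 := by
    rintro rfl
    have hnm : n₂ = m₃ := by
      by_contra hnm
      exact hR.simple j h.left_mem n₂ hn₂ m₃ hm₃ hn₂j.symm hm₃j.symm hnm _
        ((hj 2).2 (by omega)) i₂.left_mem k₃.left_mem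
    subst hnm
    have := hR.mem_unique hn₂ h.right_mem hn₂k i₂.right_mem ((hk _).2 (by omega)) k₃.right_mem
      ((hk _).2 (by omega))
    have := (framePoint_inj hef this).2
    omega
  have ha33 : a₃ ≠ 3 := by
    rintro rfl
    have hnm : n₃ = m₃ := by
      by_contra hnm
      exact hR.simple j h.left_mem n₃ hn₃ m₃ hm₃ hn₃j.symm hm₃j.symm hnm _
        ((hj 3).2 (by omega)) i₃.left_mem k₃.left_mem
    subst hnm
    have := hR.mem_unique hn₃ h.right_mem hn₃k i₃.right_mem ((hk _).2 (by omega)) k₃.right_mem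
      ((hk _).2 (by omega))
    have := (framePoint_inj hef this).2
    omega
  obtain ⟨-, v, hv⟩ := rel m₃ hm₃ hm₃j hm₃k n₂ hn₂ hn₂j hn₂k _ _ _ _ _ _ (by omega) (by omega)
      (by omega) (by omega) (by omega) (by omega) ha32 k₃ i₂
  have nzd₃ := k₃.ne_zero
  have ha₃' : 4 ≤ a₃ ∧ a₃ ≤ 6 := by
    have hd : a₃ - 3 ∣ d₃ := ⟨-(v + d₃), by linarith⟩
    have := Int.le_of_dvd (abs_pos.mpr nzd₃) ((dvd_abs _ _).mpr hd)
    have : |d₃| ≤ 3 := abs_le.mpr bd₃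
    omega
  obtain ⟨-, x, hx⟩ := rel n₃ hn₃ hn₃j hn₃k m₃ hm₃ hm₃j hm₃k _ _ _ _ _ _ (by omega) (by omega)
      (by omega) (by omega) (by omega) (by omega) (Ne.symm ha33) i₃ k₃
  have h66 : b₃ = 6 ∧ a₃ = 6 := by
    obtain ⟨p1, p2⟩ := hb₃'
    obtain ⟨q1, q2⟩ := ha₃'
    clear ht hv
    interval_cases b₃ <;> interval_cases a₃ <;> omega
  obtain ⟨rfl, rfl⟩ := h66
  -- Since `b₃ = 6 < r`, position `4` exists. Crossing the line with intercepts `(6, 3)` forces `b₄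
  -- = 4`, so `n₄` would be parallel to the line with intercepts `(2, 2)`.
  obtain ⟨n₄, hn₄, hn₄j, hn₄k, b₄, c₄, hb₄, hb₄r, i₄⟩ := left 4 (by omega) (by omega)
  obtain ⟨h24, y, hy⟩ := rel n₂ hn₂ hn₂j hn₂k n₄ hn₄ hn₄j hn₄k _ _ _ _ _ _ (by omega) (by omega)
      (by omega) (by omega) (by omega) (by omega) (by norm_num) i₂ i₄
  obtain ⟨h34, z, hz⟩ := rel m₃ hm₃ hm₃j hm₃k n₄ hn₄ hn₄j hn₄k _ _ _ _ _ _ (by omega) (by omega)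
      (by omega) (by omega) (by omega) (by omega) (by norm_num) k₃ i₄
  have hd3 : d₃ = 3 ∨ d₃ = -3 := by omega
  have hb4 : b₄ ≤ 4 := by
    have hd : b₄ - 2 ∣ 2 := by
      rcases hd3 with rfl | rfl
      · exact ⟨-z - 1, by linarith⟩
      · exact ⟨z - 1, by linarith⟩
    have := Int.le_of_dvd (by norm_num) hd
    omega
  obtain rfl : b₄ = 4 := by omega
  omega

/-- If no minimal frame has such a line, both neighbours of the origin on an axis would be free.
Only one can belong to the axis, so the origin is an endpoint of both axes, and after orienting them
`false_of_isolated` applies. -/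
theorem exists_adjacent (h : IsMinFrame r R μ j k O e f) (hR : IsTightArrangement r R)
    (hr : 4 ≤ r) : ∃ j k O e f, IsMinFrame r R μ j k O e f ∧ ∃ l ∈ R, l ≠ j ∧ l ≠ k ∧
      framePoint O e f 1 0 ∈ l := by
  by_contra! hcon
  have hno : ∀ {j k O e f}, IsMinFrame r R μ j k O e f → ∀ n ∈ R, n ≠ j →
      framePoint O e f 1 0 ∉ n := by
    intro j k O e f h n hn hnj hp
    by_cases hnk : n = k
    · subst hnk
      obtain ⟨t, ht⟩ := h.right_seg.exists_eq hp
      rw [← IsMinFrame.framePoint_right O e] at ht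
      have := (framePoint_inj h.cross_ne ht).1
      omega
    · exact hcon j k O e f h n hn hnj hnk hp
  have orient : ∀ {j k O e f}, IsMinFrame r R μ j k O e f → ∃ e', IsMinFrame r R μ j k O e' f ∧
      ∀ t : ℤ, O + t • e' ∈ j ↔ 0 ≤ t ∧ t < r := by
    intro j k O e f h
    obtain ⟨w, hw⟩ := h.left_seg.exists_window
    have w0 := (hw 0).1 (by simpa using h.origin_left)
    have hnot : ¬ (O + (1 : ℤ) • e ∈ j ∧ O + (-1 : ℤ) • e ∈ j) := by
      rintro ⟨h1, h2⟩
      rw [← framePoint_left O e f] at h1 h2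
      obtain ⟨q, hq, hqj, hq' | hq'⟩ := hR.exists_mem_or h.left_mem h1 h2
        (fun h0 => by have := (framePoint_inj h.cross_ne h0).1; omega)
      · exact hno h q hq hqj hq'
      · exact hno h.neg_left q hq hqj (by rwa [framePoint_neg_left])
    rw [hw, hw] at hnot
    have hcase : w = 0 ∨ w + r = 1 := by omega
    rcases hcase with hcase | hcase
    · exact ⟨e, h, fun t => by rw [hw]; omega⟩
    · refine ⟨-e, h.neg_left, fun t => ?_⟩
      rw [smul_neg, ← neg_smul, hw]
      omega
  obtain ⟨e', h', hj⟩ := orient h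
  obtain ⟨f', h'', hk⟩ := orient h'.swap
  refine h''.swap.false_of_isolated hR hr (fun t => by rw [framePoint_left]; exact hj t)
    (fun t => by rw [framePoint_right]; exact hk t) (hno h''.swap) (fun n hn hnk => ?_)
  rw [framePoint_swap]
  exact hno h'' n hn hnk

end IsMinFrame

theorem IsTightArrangement.exists_chain_two {r : ℕ} {R : Finset (Finset (ℤ × ℤ))}
    (hR : IsTightArrangement r R) (hr : 4 ≤ r) :
    ∃ μ O e f g, IsParabolicChain r R μ O e f g 0 2 := by
  obtain ⟨μ, j, k, O, e, f, h⟩ := hR.exists_isMinFrame (by rw [hR.card_eq]; omega)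
  refine ⟨μ, ?_⟩
  obtain ⟨j, k, O, e, f, h, l, hl, hlj, hlk, hla⟩ := h.exists_adjacent hR hr
  obtain ⟨b, hb, hbk, hbl⟩ := h.exists_right_le_two hR hl hlj hlk hla
  have hja : framePoint O e f 1 0 ∈ j := by
    obtain ⟨a, ha, haj, hal⟩ := h.exists_left hR hl hlj hlk
    obtain ⟨c, hc⟩ := h.left_seg.exists_eq haj
    obtain ⟨p, d, hd⟩ := hR.seg l hl
    have := hd.collinear h.cross_ne hbl hla hal
    have hb0 : b ≠ 0 := by omega
    have : b * (a - 1) = 0 := by linarith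
    rcases mul_eq_zero.mp this with h0 | h0
    · exact absurd h0 hb0
    · rwa [show a = 1 by omega] at haj
  rcases hb with rfl | rfl | hb
  · exact IsUnitTriangle.exists_chain ⟨h, hl, hlj, hlk, hja, hla, hbk, hbl⟩ hR hr
  · exact IsUnitTriangle.exists_chain (f := -f) ⟨h.neg_right, hl, hlj, hlk,
      by simpa [framePoint] using hja, by simpa [framePoint] using hla,
      by simpa [framePoint] using hbk, by simpa [framePoint] using hbl⟩ hR hr
  · exact h.exists_chain' hR hl hlj hlk hla hb hbl

/-! ### Prolonging a chain until it is the whole arrangement -/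

namespace IsParabolicChain

variable {r : ℕ} {R : Finset (Finset (ℤ × ℤ))} {μ : ℤ} {O e f : ℤ × ℤ}
  {g : ℤ → Finset (ℤ × ℤ)} {k : ℤ}

/-- The point `(2k, k² - 1)` is position `k + 1` on tangent `k - 1`, where tangent `k + 1` would
cross it. -/
theorem exists_extension (h : IsParabolicChain r R μ O e f g 0 k) (hR : IsTightArrangement r R)
    (hk : 2 ≤ k) {n : Finset (ℤ × ℤ)} (hn : n ∈ R) (hn1 : n ≠ g (k - 1))
    (hnp : framePoint O e f (2 * k) (k * k - 1) ∈ n) :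
    ∃ O e f g, IsParabolicChain r R μ O e f g 0 (k + 1) := by
  have h' := (h.shift k).mono (a' := -2) (b' := 0) (by omega) (by omega)
  have hs := h'.segOn_next hR hn (by rwa [show -1 + k = k - 1 by ring]) (by
    rw [framePoint_shift]
    convert hnp using 1
    ring_nf)
  refine ⟨O, e, f, _, h.extend hn ?_⟩
  convert hs.shift (-k) using 1
  · ext <;> simp [framePoint] <;> ring
  · ext <;> simp <;> ring

theorem exists_extension_left (h : IsParabolicChain r R μ O e f g 0 k)
    (hR : IsTightArrangement r R) (hk : 2 ≤ k) {n : Finset (ℤ × ℤ)} (hn : n ∈ R) (hn1 : n ≠ g 1)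
    (hnp : framePoint O e f 0 (-1) ∈ n) :
    ∃ O e f g, IsParabolicChain r R μ O e f g 0 (k + 1) := by
  have h' := (h.reverse.shift (-k)).mono (a' := 0) (b' := k) (by omega) (by omega)
  refine h'.exists_extension hR hk hn ?_ ?_
  · simpa using hn1
  · rw [framePoint_shift, framePoint_neg_left]
    convert hnp using 1
    ring_nf

theorem tangency_notMem (h : IsParabolicChain r R μ O e f g 0 k) (hR : IsTightArrangement r R)
    {i : ℤ} (hi : 1 ≤ i) (hi' : i + 1 ≤ k) {n : Finset (ℤ × ℤ)} (hn : n ∈ R) (hni : n ≠ g i) :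
    framePoint O e f (i + i) (i * i) ∉ n := by
  have h' := (h.shift i).mono (a' := -1) (b' := 1) (by omega) (by omega)
  have := h'.origin_notMem hR hn (by simpa using hni)
  rw [framePoint_shift] at this
  convert this using 2
  ring_nf

theorem window (h : IsParabolicChain r R μ O e f g 0 k) {i : ℤ} (hi : 0 ≤ i) (hi' : i ≤ k) :
    ∃ w : ℤ, ∀ t, framePoint O e f (i + t) (i * t) ∈ g i ↔ w ≤ t ∧ t < w + r := by
  obtain ⟨w, hw⟩ := (h.seg i hi hi').exists_window
  refine ⟨w, fun t => ?_⟩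
  rw [← framePoint_tangent, hw]

/-- A parabolic chain that cannot be prolonged is the whole arrangement. -/
theorem card_le_of_maximal (h : IsParabolicChain r R μ O e f g 0 k) (hR : IsTightArrangement r R)
    (hr : 4 ≤ r) (hk : 2 ≤ k)
    (hmax : ¬ ∃ O e f g, IsParabolicChain r R μ O e f g 0 (k + 1)) : r ≤ k + 1 := by
  by_contra! hlt
  have hef := h.cross_ne
  have hA := hR.toIsArrangement
  obtain ⟨w, hw⟩ := h.window (i := 1) (by omega) (by omega)
  obtain ⟨x, hx⟩ := h.window (i := k - 1) (by omega) (by omega)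
  have w0 := (hw 0).1 (h.meet_mem hR (i := 1) (j := 0) (by omega) (by omega) (by omega) (by omega)
    (by omega))
  have w2 := (hw 2).1 (h.meet_mem hR (i := 1) (j := 2) (by omega) (by omega) (by omega) (by omega)
    (by omega))
  have xk := (hx k).1 (h.meet_mem hR (i := k - 1) (j := k) (by omega) (by omega) (by omega)
    (by omega) (by omega))
  have x2 := (hx (k - 2)).1 (h.meet_mem hR (i := k - 1) (j := k - 2) (by omega) (by omega)
    (by omega) (by omega) (by omega))
  -- The point of tangency is already the free point of tangent `1`, so position `-1`, if present,
  -- would be occupied and prolong the chain. The other end of the chain is treated alike in `hxk`.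
  have hw0 : w = 0 := by
    by_contra hne
    obtain ⟨n, hn, hn1, hn'⟩ := hR.exists_mem_or (h.mem 1 (by omega) (by omega))
      ((hw 1).2 (by omega)) ((hw (-1)).2 (by omega)) (fun h0 => by
        have := (framePoint_inj hef h0).1
        omega)
    have := hn'.resolve_left (h.tangency_notMem hR (by omega) (by omega) hn hn1)
    exact hmax (h.exists_extension_left hR hk hn hn1 (by simpa using this))
  have hxk : x + r = k + 1 := by
    by_contra hne
    obtain ⟨n, hn, hn1, hn'⟩ := hR.exists_mem_or (h.mem (k - 1) (by omega) (by omega))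
      ((hx (k - 1)).2 (by omega)) ((hx (k + 1)).2 (by omega)) (fun h0 => by
        have := (framePoint_inj hef h0).1
        omega)
    have := hn'.resolve_left (h.tangency_notMem hR (by omega) (by omega) hn hn1)
    refine hmax (h.exists_extension hR hk hn hn1 ?_)
    convert this using 1
    ring_nf
  -- Tangent `1` starts at position `0` and has more than `k + 1` points, so it reaches position `k
  -- + 1`. The line `m` found there is not in the chain.
  obtain ⟨m, hm, hm1, hm'⟩ := hR.exists_mem_or (h.mem 1 (by omega) (by omega))
    ((hw 1).2 (by omega)) ((hw (k + 1)).2 (by omega)) (fun h0 => by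
      have := (framePoint_inj hef h0).1
      omega)
  have hmp := hm'.resolve_left (h.tangency_notMem hR (by omega) (by omega) hm hm1)
  have hmi : ∀ i, 0 ≤ i → i ≤ k → m ≠ g i := by
    rintro i h1 h2 rfl
    obtain ⟨t, h3, h4⟩ := h.exists_eq h1 h2 hmp
    have : (i - 1) * (t - 1) = 0 := by linarith
    rcases mul_eq_zero.mp this with h5 | h5
    · exact hm1 (by rw [show i = 1 by omega])
    · omega
  have hhit : ∀ i, 0 ≤ i → i ≤ k → ∃ t, framePoint O e f (i + t) (i * t) ∈ g i ∧
      framePoint O e f (i + t) (i * t) ∈ m := fun i h1 h2 =>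
    h.exists_hit hA subset_rfl hm h1 h2 (hmi i h1 h2)
  have hout : ∀ i t, 0 ≤ i → i ≤ k → 0 ≤ t → t ≤ k → i ≠ t →
      framePoint O e f (i + t) (i * t) ∉ m := fun i t h1 h2 h3 h4 h5 =>
    h.notMem hR hm h1 h2 h3 h4 h5 (hmi i h1 h2) (hmi t h3 h4)
  obtain ⟨p, d, hd⟩ := hR.seg m hm
  obtain ⟨u, hu, hu'⟩ := hhit (k - 1) (by omega) (by omega)
  have ux := (hx u).1 hu
  have hu1 : u ≤ -1 := by
    by_contra hu0
    by_cases huk : u = k - 1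
    · subst huk
      exact h.tangency_notMem hR (by omega) (by omega) hm (hmi _ (by omega) (by omega)) hu'
    · exact hout (k - 1) u (by omega) (by omega) (by omega) (by omega) (Ne.symm huk) hu'
  have hk3 : 3 ≤ k := by
    by_contra hk3
    obtain rfl : k = 2 := by omega
    have := (hx 3).1 (by simpa using (hw 3).2 (by omega))
    omega
  obtain ⟨y, -, hy⟩ := hhit k (by omega) (by omega)
  have hy1 : y ≤ -1 ∨ k ≤ y := by
    by_contra! hy0
    exact hout k y (by omega) (by omega) (by omega) (by omega) (by omega) hy
  obtain ⟨z, -, hz⟩ := hhit 2 (by omega) (by omega)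
  have c1 := hd.collinear hef hmp hy hu'
  have c2 := hd.collinear hef hmp hy hz
  -- Collinearity on tangents `1`, `k - 1`, `k` forces `3 ≤ j ≤ k - 2`. With tangent `2`, the number
  -- `(k - 2) j - (k - 1)` divides `k - 1 + j`, so `k ≤ 7`. Only `k = 7`, `j = 3` survives, where
  -- `m` is parallel to tangent `5`.
  obtain ⟨j, rfl⟩ : ∃ j, y = 2 - j := ⟨2 - y, by ring⟩
  have e1 : (k + 1 - u) * (k - 1 - j) = (k - 2) * (k - 1 + j) := by linear_combination c1
  have e2 : (z - k - 1) * ((k - 2) * j - (k - 1)) = k - 1 + j := by linear_combination c2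
  have hj3 : 3 ≤ j := by
    by_contra hj
    have hj2 : j ≤ 2 - k := by omega
    have h1 : (k + 2) * (2 * k - 3) ≤ (k + 1 - u) * (k - 1 - j) := by
      apply mul_le_mul <;> omega
    have h2 : (k - 2) * (k - 1 + j) ≤ (k - 2) * 1 := by
      apply mul_le_mul_of_nonneg_left <;> omega
    nlinarith
  have hjk : j ≤ k - 2 := by
    by_contra hj
    have h1 : (k + 1 - u) * (k - 1 - j) ≤ 0 :=
      mul_nonpos_of_nonneg_of_nonpos (by omega) (by omega)
    have h2 : 0 < (k - 2) * (k - 1 + j) := mul_pos (by omega) (by omega)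
    omega
  have hle : (k - 2) * j - (k - 1) ≤ k - 1 + j :=
    Int.le_of_dvd (by omega) ⟨z - k - 1, by linarith⟩
  have hk7 : k ≤ 7 := by nlinarith
  have hk5 : 5 ≤ k := by omega
  have hfin : k = 7 ∧ j = 3 := by
    clear c1 c2 e1
    interval_cases k <;> interval_cases j <;> omega
  obtain ⟨rfl, rfl⟩ := hfin
  obtain ⟨v, -, hv⟩ := hhit 5 (by omega) (by omega)
  have c3 := hd.collinear hef hmp hy hv
  omega

end IsParabolicChain

/-- A tight arrangement of at least four progressions is a parabolic chain. -/
theorem IsTightArrangement.exists_chain {r : ℕ} {R : Finset (Finset (ℤ × ℤ))}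
    (hR : IsTightArrangement r R) (hr : 4 ≤ r) :
    ∃ μ O e f g, IsParabolicChain r R μ O e f g 0 (r - 1) := by
  classical
  obtain ⟨μ, h2⟩ := hR.exists_chain_two hr
  refine ⟨μ, ?_⟩
  have hcard : ∀ k : ℕ, (∃ O e f g, IsParabolicChain r R μ O e f g 0 (k : ℤ)) → k + 1 ≤ r := by
    rintro k ⟨O, e, f, g, h⟩
    have : ((Finset.range (k + 1)).image fun i : ℕ => g i) ⊆ R := by
      intro l hl
      obtain ⟨i, hi, rfl⟩ := Finset.mem_image.mp hl
      rw [Finset.mem_range] at hi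
      exact h.mem i (by omega) (by omega)
    have h1 := Finset.card_le_card this
    rwa [hR.card_eq, Finset.card_image_of_injOn, Finset.card_range] at h1
    intro i hi j hj hij
    simp only [Finset.coe_range, Set.mem_Iio] at hi hj
    by_contra hne
    exact h.ne hR.two_le (i := i) (j := j) (by omega) (by omega) (by omega) (by omega)
      (by omega) hij
  by_contra hno
  -- Chains that never reach length `r` could be prolonged forever, although their members are
  -- distinct elements of `R`.
  have hall : ∀ k : ℕ, ∃ O e f g, IsParabolicChain r R μ O e f g 0 ((k + 2 : ℕ) : ℤ) := by
    intro k
    induction k with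
    | zero => exact h2
    | succ k ih =>
      by_contra hcon
      have hk := hcard _ ih
      obtain ⟨O, e, f, g, h⟩ := ih
      have := h.card_le_of_maximal hR hr (by omega) (by
        convert hcon using 6
        push_cast
        ring_nf)
      refine hno ⟨O, e, f, g, ?_⟩
      convert h using 1
      omega
  have := hcard _ (hall r)
  omega

/-! ### Lines outside a complete chain -/

theorem cross_eq_zero_of_parallel {f d d' : ℤ × ℤ} (hf : f ≠ 0) (h : cross f d = 0)
    (h' : cross f d' = 0) : cross d d' = 0 := by
  unfold cross at *
  by_contra hne
  apply hf
  have h1 : f.1 * (d.1 * d'.2 - d.2 * d'.1) = 0 := by linear_combination d.1 * h' - d'.1 * h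
  have h2 : f.2 * (d.1 * d'.2 - d.2 * d'.1) = 0 := by linear_combination d.2 * h' - d'.2 * h
  ext
  · exact (mul_eq_zero.mp h1).resolve_right hne
  · exact (mul_eq_zero.mp h2).resolve_right hne

/-- A line `α x + β y = γ` that meets each tangent `i` of a parabola, `0 ≤ i < r`, at an integral
position `t i` in a window of length `r`. -/
structure IsIntegralSecant (r : ℤ) (α β γ : ℤ) (t : ℤ → ℤ) : Prop where
  eq : ∀ i, 0 ≤ i → i < r → α * (i + t i) + β * (i * t i) = γ
  ne : ∀ i, 0 ≤ i → i < r → α + β * i ≠ 0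
  neg_one_le : ∀ i, 0 ≤ i → i < r → -1 ≤ t i
  le : ∀ i, 0 ≤ i → i < r → t i ≤ r
  nonneg : ∀ i, 0 ≤ i → i < r - 1 → 0 ≤ t i
  lt : ∀ i, 1 ≤ i → i < r → t i < r

namespace IsIntegralSecant

variable {r α β γ : ℤ} {t : ℤ → ℤ}

/-- The relation between `i` and `t i` is symmetric. An integer `v` strictly between `t i` and `t (i
+ 1)` would, with no pole between `i` and `i + 1`, have `t v` strictly between `i` and `i + 1`. -/
theorem step (h : IsIntegralSecant r α β γ t) {i : ℤ} (hi : 0 ≤ i) (hi' : i + 1 < r)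
    (hs : 0 < (α + β * i) * (α + β * (i + 1))) : t (i + 1) = t i + 1 ∨ t (i + 1) = t i - 1 := by
  have e0 := h.eq i hi (by omega)
  have e1 := h.eq (i + 1) (by omega) hi'
  have b0 := h.nonneg i hi (by omega)
  have b0' := h.le i hi (by omega)
  have b1 := h.neg_one_le (i + 1) (by omega) hi'
  have b1' := h.lt (i + 1) (by omega) hi'
  have key : ∀ v, (v - t i) * (v - t (i + 1)) < 0 → 0 ≤ v → v < r → False := by
    intro v hv h1 h2
    have e2 := h.eq v h1 h2
    have h3 : (v - t i) * (α + β * i) = (α + β * v) * (i - t v) := by linear_combination e2 - e0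
    have h4 : (v - t (i + 1)) * (α + β * (i + 1)) = (α + β * v) * (i + 1 - t v) := by
      linear_combination e2 - e1
    have h5 : (v - t i) * (v - t (i + 1)) * ((α + β * i) * (α + β * (i + 1))) =
        (α + β * v) ^ 2 * ((i - t v) * (i + 1 - t v)) := by
      linear_combination (v - t (i + 1)) * (α + β * (i + 1)) * h3 + (α + β * v) * (i - t v) * h4
    have h6 : 0 ≤ (i - t v) * (i + 1 - t v) := by
      rcases le_or_gt (t v) i with h7 | h7
      · exact mul_nonneg (by omega) (by omega)
      · exact mul_nonneg_of_nonpos_of_nonpos (by omega) (by omega)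
    have h8 := mul_neg_of_neg_of_pos hv hs
    have h9 := mul_nonneg (sq_nonneg (α + β * v)) h6
    omega
  have hne : t (i + 1) ≠ t i := by
    intro he
    rw [he] at e1 b1 b1'
    exact h.ne (t i) b0 b1' (by linear_combination e1 - e0)
  rcases lt_or_gt_of_ne hne with hlt | hlt
  · by_contra hcon
    exact key (t (i + 1) + 1) (mul_neg_of_neg_of_pos (by omega) (by omega)) (by omega) (by omega)
  · by_contra hcon
    exact key (t i + 1) (mul_neg_of_pos_of_neg (by omega) (by omega)) (by omega) (by omega)

/-- For `β ≠ 0` the Möbius function is neither affine on three consecutive integers nor able to turn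
back: two equal steps give `2 β = 0`, opposite ones put a pole at `i + 1`. -/
theorem eq_zero_of_sign (h : IsIntegralSecant r α β γ t) {i : ℤ} (hi : 0 ≤ i) (hi' : i + 2 < r)
    (hs : 0 < (α + β * i) * (α + β * (i + 1))) (hs' : 0 < (α + β * (i + 1)) * (α + β * (i + 2))) :
    β = 0 := by
  have e0 := h.eq i hi (by omega)
  have e1 := h.eq (i + 1) (by omega) (by omega)
  have e2 := h.eq (i + 2) (by omega) (by omega)
  have hq := h.ne (i + 1) (by omega) (by omega)
  have s1 := h.step hi (by omega) hs
  have s2 := h.step (i := i + 1) (by omega) (by omega) (by rwa [show i + 1 + 1 = i + 2 by ring])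
  rw [show i + 1 + 1 = i + 2 by ring] at s2
  rcases s1 with s1 | s1 <;> rcases s2 with s2 | s2 <;> rw [s2, s1] at e2 <;> rw [s1] at e1
  · have : 2 * β = 0 := by linear_combination e2 - 2 * e1 + e0
    omega
  · have h1 : β * (t i - i - 1) = 0 := by linear_combination e2 - e1
    rcases mul_eq_zero.mp h1 with h2 | h2
    · exact h2
    · rw [show t i = i + 1 by omega] at e0 e1
      exact absurd (by linarith : α + β * (i + 1) = 0) hq
  · have h1 : β * (t i - i - 1) = 0 := by linear_combination e1 - e0
    rcases mul_eq_zero.mp h1 with h2 | h2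
    · exact h2
    · rw [show t i = i + 1 by omega] at e0 e2
      exact absurd (by linarith : α + β * (i + 1) = 0) hq
  · have h1 : 2 * β = 0 := by linear_combination -e2 + 2 * e1 - e0
    omega

theorem eq_zero_of_sign' (h : IsIntegralSecant r α β γ t) {i : ℤ} (hi : 0 ≤ i) (hi' : i + 2 < r)
    (hs : (0 < α + β * i ∧ 0 < α + β * (i + 2)) ∨ (α + β * i < 0 ∧ α + β * (i + 2) < 0)) :
    β = 0 := by
  have hm : 2 * (α + β * (i + 1)) = (α + β * i) + (α + β * (i + 2)) := by ring
  rcases hs with ⟨h1, h2⟩ | ⟨h1, h2⟩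
  · exact h.eq_zero_of_sign hi hi' (mul_pos h1 (by omega)) (mul_pos (by omega) h2)
  · exact h.eq_zero_of_sign hi hi' (mul_pos_of_neg_of_neg h1 (by omega))
      (mul_pos_of_neg_of_neg (by omega) h2)

/-- The affine function `α + β i` changes sign at most once, so it has the same sign at `0` and `2`
or at `2` and `4`. -/
theorem eq_zero (h : IsIntegralSecant r α β γ t) (hr : 5 ≤ r) : β = 0 := by
  have q0 := h.ne 0 (by omega) (by omega)
  have q2 := h.ne 2 (by omega) (by omega)
  have q4 := h.ne 4 (by omega) (by omega)
  by_cases h0 : (0 < α + β * 0 ∧ 0 < α + β * (0 + 2)) ∨ (α + β * 0 < 0 ∧ α + β * (0 + 2) < 0)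
  · exact h.eq_zero_of_sign' (by omega) (by omega) h0
  · exact h.eq_zero_of_sign' (i := 2) (by omega) (by omega) (by omega)

/-- If `β ≠ 0`, the pole lies between `1` and `2`, so `t` makes unit steps from `0` to `1` and from
`2` to `3`. Two of the four sign patterns put the pole at `3/2`; the other two require a positive
quadratic expression to vanish. -/
theorem eq_zero_or_of_four (h : IsIntegralSecant 4 α β γ t) : β = 0 ∨ 2 * α + 3 * β = 0 := by
  by_contra! hcon
  obtain ⟨hβ, hne⟩ := hcon
  have q0 := h.ne 0 (by omega) (by omega)
  have q1 := h.ne 1 (by omega) (by omega)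
  have q2 := h.ne 2 (by omega) (by omega)
  have q3 := h.ne 3 (by omega) (by omega)
  have n0 : ¬ _ := fun h0 => hβ (h.eq_zero_of_sign' (i := 0) (by omega) (by omega) h0)
  have n1 : ¬ _ := fun h0 => hβ (h.eq_zero_of_sign' (i := 1) (by omega) (by omega) h0)
  have s01 : t 1 = t 0 + 1 ∨ t 1 = t 0 - 1 := by
    refine h.step (i := 0) (by omega) (by omega) ?_
    rcases lt_or_gt_of_ne q0 with h0 | h0
    · exact mul_pos_of_neg_of_neg h0 (by omega)
    · exact mul_pos h0 (by omega)
  have s23 : t 3 = t 2 + 1 ∨ t 3 = t 2 - 1 := by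
    refine h.step (i := 2) (by omega) (by omega) ?_
    rcases lt_or_gt_of_ne q2 with h0 | h0
    · exact mul_pos_of_neg_of_neg h0 (by omega)
    · exact mul_pos h0 (by omega)
  have e0 := h.eq 0 (by omega) (by omega)
  have e1 := h.eq 1 (by omega) (by omega)
  have e2 := h.eq 2 (by omega) (by omega)
  have e3 := h.eq 3 (by omega) (by omega)
  have b1 := h.lt 1 (by omega) (by omega)
  have b2 := h.nonneg 2 (by omega) (by omega)
  have b0 := h.nonneg 0 (by omega) (by omega)
  rcases s01 with s1 | s1 <;> rcases s23 with s3 | s3 <;> rw [s1] at e1 b1 <;> rw [s3] at e3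
  · have h1 : β * (t 0 - t 2 - 2) = 0 := by linear_combination e1 - e0 - e3 + e2
    have h2 := (mul_eq_zero.mp h1).resolve_left hβ
    have h3 : t 0 = 2 := by omega
    rw [h3] at e0 e1
    exact hne (by linarith)
  · have h1 : β * (t 2 - 3) = 0 := by linear_combination e3 - e2
    have h2 : t 2 = 3 := by have := (mul_eq_zero.mp h1).resolve_left hβ; omega
    rw [h2] at e2
    have h3 : β * ((t 0 - 2) ^ 2 + 3) = 0 := by
      linear_combination -(5 - t 0) * (e1 - e0) - 2 * (e0 - e2)
    exact (mul_ne_zero hβ (by positivity)) h3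
  · have h1 : β * (t 0 - 1) = 0 := by linear_combination e1 - e0
    have h2 : t 0 = 1 := by have := (mul_eq_zero.mp h1).resolve_left hβ; omega
    rw [h2] at e0
    have h3 : β * (t 2 ^ 2 + 3) = 0 := by
      linear_combination (1 + t 2) * (e3 - e2) + 2 * (e0 - e2)
    exact (mul_ne_zero hβ (by positivity)) h3
  · have h1 : β * (t 0 - 1) = 0 := by linear_combination e1 - e0
    have h2 : t 0 = 1 := by have := (mul_eq_zero.mp h1).resolve_left hβ; omega
    have h3 : β * (t 2 - 3) = 0 := by linear_combination e3 - e2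
    have h4 : t 2 = 3 := by have := (mul_eq_zero.mp h3).resolve_left hβ; omega
    rw [h2] at e0
    rw [h4] at e2
    exact hne (by linarith)

end IsIntegralSecant

/-- Tangent `i` contains every position `j ≠ i` with `0 ≤ j < r`, so an inner tangent occupies
exactly `0, …, r - 1`. Only the two end tangents may be shifted by one, which explains the weaker
bounds for them. -/
theorem IsParabolicChain.exists_isIntegralSecant {r : ℕ} {R L : Finset (Finset (ℤ × ℤ))} {μ : ℤ}
    {O e f : ℤ × ℤ} {g : ℤ → Finset (ℤ × ℤ)} (h : IsParabolicChain r R μ O e f g 0 (r - 1))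
    (hR : IsTightArrangement r R) (hr : 4 ≤ r) (hL : IsArrangement r L) (hRL : R ⊆ L)
    {m : Finset (ℤ × ℤ)} (hm : m ∈ L) (hmR : m ∉ R) {p d : ℤ × ℤ} (hd : SegOn r m p d) :
    ∃ γ t, IsIntegralSecant r (cross e d) (cross f d) γ t := by
  have hmi : ∀ i : ℤ, 0 ≤ i → i < r → m ≠ g i := by
    rintro i h1 h2 rfl
    exact hmR (h.mem i h1 (by omega))
  have hex : ∀ i : ℤ, ∃ t, 0 ≤ i → i < r → framePoint O e f (i + t) (i * t) ∈ g i ∧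
      framePoint O e f (i + t) (i * t) ∈ m := by
    intro i
    by_cases hi : 0 ≤ i ∧ i < r
    · obtain ⟨t, ht⟩ := h.exists_hit hL hRL hm hi.1 (by omega) (hmi i hi.1 hi.2)
      exact ⟨t, fun _ _ => ht⟩
    · exact ⟨0, fun h1 h2 => absurd ⟨h1, h2⟩ hi⟩
  choose t ht using hex
  have hwin : ∀ i : ℤ, 0 ≤ i → i < r → ∀ j j' : ℤ, 0 ≤ j → j < r → i ≠ j → 0 ≤ j' → j' < r →
      i ≠ j' → t i < j + r ∧ j' - r < t i := by
    intro i h1 h2 j j' h3 h4 h5 h6 h7 h8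
    obtain ⟨w, hw⟩ := h.window h1 (by omega)
    have a1 := (hw j).1 (h.meet_mem hR h1 (by omega) h3 (by omega) h5)
    have a2 := (hw j').1 (h.meet_mem hR h1 (by omega) h6 (by omega) h8)
    have a3 := (hw (t i)).1 (ht i h1 h2).1
    omega
  refine ⟨cross (p - O) d, t, ?_, ?_, ?_, ?_, ?_, ?_⟩
  · intro i h1 h2
    obtain ⟨s, hs⟩ := hd.exists_eq (ht i h1 h2).2
    simp only [framePoint, Prod.ext_iff, Prod.fst_add, Prod.snd_add, Prod.smul_fst, Prod.smul_snd,
      smul_eq_mul] at hs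
    simp only [cross, Prod.fst_sub, Prod.snd_sub]
    linear_combination d.2 * hs.1 - d.1 * hs.2
  · intro i h1 h2
    have := hL.cross_ne _ (hRL (h.mem i h1 (by omega))) m hm (hmi i h1 h2).symm _ _ _ _
      (h.seg i h1 (by omega)) hd
    intro h0
    apply this
    rw [← h0]
    simp [cross]
    ring
  · intro i h1 h2
    by_cases hi : i = r - 1
    · have := hwin i h1 h2 0 (r - 2) (by omega) (by omega) (by omega) (by omega) (by omega)
        (by omega)
      omega
    · have := hwin i h1 h2 (r - 1) (r - 1) (by omega) (by omega) (by omega) (by omega) (by omega)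
        (by omega)
      omega
  · intro i h1 h2
    by_cases hi : i = 0
    · have := hwin i h1 h2 1 1 (by omega) (by omega) (by omega) (by omega) (by omega)
        (by omega)
      omega
    · have := hwin i h1 h2 0 0 (by omega) (by omega) (by omega) (by omega) (by omega)
        (by omega)
      omega
  · intro i h1 h2
    have := hwin i h1 (by omega) (r - 1) (r - 1) (by omega) (by omega) (by omega) (by omega)
      (by omega) (by omega)
    omega
  · intro i h1 h2
    have := hwin i (by omega) h2 0 0 (by omega) (by omega) (by omega) (by omega)
      (by omega) (by omega)
    omega

/-- An arrangement containing a tight one has at most one more line, or two if `r = 4`. -/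
theorem IsTightArrangement.card_le {r : ℕ} {R L : Finset (Finset (ℤ × ℤ))}
    (hR : IsTightArrangement r R) (hr : 4 ≤ r) (hL : IsArrangement r L) (hRL : R ⊆ L) :
    L.card ≤ r + 1 ∨ (r = 4 ∧ L.card ≤ 6) := by
  classical
  obtain ⟨μ, O, e, f, g, h⟩ := hR.exists_chain hr
  have hcard : L.card = r + (L \ R).card := by
    rw [← hR.card_eq, add_comm, Finset.card_sdiff_add_card_eq_card hRL]
  have hef := h.cross_ne
  have hf : f ≠ 0 := by
    rintro rfl
    simp [cross] at hef
  -- Each direction is taken by at most one line, so the additional lines are counted by their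
  -- possible directions.
  have hpar : ∀ m ∈ L \ R, ∀ n ∈ L \ R, ∀ v : ℤ × ℤ, v ≠ 0 →
      (∀ p d, SegOn r m p d → cross v d = 0) → (∀ p d, SegOn r n p d → cross v d = 0) →
      m = n := by
    intro m hm n hn v hv h1 h2
    by_contra hmn
    rw [Finset.mem_sdiff] at hm hn
    obtain ⟨p, d, hd⟩ := hL.seg m hm.1
    obtain ⟨p', d', hd'⟩ := hL.seg n hn.1
    exact hL.cross_ne m hm.1 n hn.1 hmn _ _ _ _ hd hd'
      (cross_eq_zero_of_parallel hv (h1 _ _ hd) (h2 _ _ hd'))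
  rcases eq_or_lt_of_le hr with h4 | h5
  · right
    refine ⟨h4.symm, ?_⟩
    have hle : (L \ R).card ≤ (Finset.univ : Finset Bool).card := by
      have hdir : ∀ m ∈ L \ R, ∃ b : Bool, ∀ p d, SegOn r m p d →
          cross (if b then f else (2 : ℤ) • e + (3 : ℤ) • f) d = 0 := by
        intro m hm
        rw [Finset.mem_sdiff] at hm
        obtain ⟨p, d, hd⟩ := hL.seg m hm.1
        obtain ⟨γ, t, hs⟩ := h.exists_isIntegralSecant hR hr hL hRL hm.1 hm.2 hd
        rw [← h4] at hs
        have hd0 : ∀ v, cross v d = 0 → ∀ p' d', SegOn r m p' d' → cross v d' = 0 := by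
          intro v hv p' d' hd'
          have h1 := hd.cross_eq_zero hd' hL.two_le
          rw [cross_swap] at hv ⊢
          rw [neg_eq_zero] at hv ⊢
          rw [cross_swap, cross_eq_zero_of_parallel hd.step_ne_zero hv h1, neg_zero]
        rcases hs.eq_zero_or_of_four with h0 | h0
        · exact ⟨true, hd0 _ h0⟩
        · refine ⟨false, hd0 _ ?_⟩
          rw [← h0]
          simp [cross]
          ring
      choose! b hb using hdir
      refine Finset.card_le_card_of_injOn b (fun _ _ => by simp) ?_
      intro m hm n hn hmn
      refine hpar m hm n hn _ ?_ (hb m hm) (by rw [hmn]; exact hb n hn)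
      split_ifs
      · exact hf
      · intro h0
        apply hef
        have h1 : 2 * cross e f = cross ((2 : ℤ) • e + (3 : ℤ) • f) f := by
          simp [cross]
          ring
        rw [h0] at h1
        simp [cross] at h1 ⊢
        exact h1
    simp at hle
    omega
  · left
    have hle : (L \ R).card ≤ 1 := by
      rw [Finset.card_le_one]
      have hdir : ∀ m ∈ L \ R, ∀ p d, SegOn r m p d → cross f d = 0 := by
        intro m hm p d hd
        rw [Finset.mem_sdiff] at hm
        obtain ⟨γ, t, hs⟩ := h.exists_isIntegralSecant hR hr hL hRL hm.1 hm.2 hd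
        exact hs.eq_zero (by omega)
      intro m hm n hn
      exact hpar m hm n hn f hf (hdir m hm) (hdir n hn)
    omega

/-! ### 2-packings and transversals of linear systems; the case of three points per line -/

namespace LinearSystem

variable {α : Type*} [DecidableEq α]

theorem bddAbove_twoPacking (S : LinearSystem α) :
    BddAbove {k : ℕ | ∃ R : Finset (Finset α), S.IsTwoPacking R ∧ R.card = k} := by
  refine ⟨S.lines.card, ?_⟩
  rintro _ ⟨R, hR, rfl⟩
  exact Finset.card_le_card hR.1

theorem IsTwoPacking.card_le {S : LinearSystem α} {R : Finset (Finset α)} (hR : S.IsTwoPacking R) :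
    R.card ≤ S.twoPackingNumber :=
  le_csSup S.bddAbove_twoPacking ⟨R, hR, rfl⟩

theorem exists_isTwoPacking (S : LinearSystem α) :
    ∃ R, S.IsTwoPacking R ∧ R.card = S.twoPackingNumber :=
  Nat.sSup_mem (s := {k : ℕ | ∃ R : Finset (Finset α), S.IsTwoPacking R ∧ R.card = k})
    ⟨0, ∅, ⟨by simp, by simp⟩, rfl⟩ S.bddAbove_twoPacking

theorem mem_unique (S : LinearSystem α) {l m : Finset α} (hl : l ∈ S.lines) (hm : m ∈ S.lines)
    (hlm : l ≠ m) {x y : α} (hxl : x ∈ l) (hxm : x ∈ m) (hyl : y ∈ l) (hym : y ∈ m) : x = y :=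
  Finset.card_le_one.mp (S.card_inter_le_one l hl m hm hlm) x (by simp [hxl, hxm]) y
    (by simp [hyl, hym])

theorem IsIntersecting.exists_mem {S : LinearSystem α} (hS : S.IsIntersecting) {l m : Finset α}
    (hl : l ∈ S.lines) (hm : m ∈ S.lines) (hlm : l ≠ m) : ∃ x, x ∈ l ∧ x ∈ m := by
  have h := hS l hl m hm hlm
  obtain ⟨x, hx⟩ := Finset.card_pos.mp (by omega : 0 < (l ∩ m).card)
  exact ⟨x, Finset.mem_inter.mp hx⟩

theorem exists_common_of_not_isTwoPacking {S : LinearSystem α} {R : Finset (Finset α)}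
    (hR : R ⊆ S.lines) (h : ¬ S.IsTwoPacking R) : ∃ a ∈ R, ∃ b ∈ R, ∃ c ∈ R,
      a ≠ b ∧ a ≠ c ∧ b ≠ c ∧ ∃ x, x ∈ a ∧ x ∈ b ∧ x ∈ c := by
  simp only [IsTwoPacking, not_and, not_forall] at h
  obtain ⟨a, ha, b, hb, c, hc, hab, hac, hbc, hne⟩ := h hR
  obtain ⟨x, hx⟩ := Finset.nonempty_iff_ne_empty.mpr hne
  simp only [Finset.mem_inter] at hx
  exact ⟨a, ha, b, hb, c, hc, hab, hac, hbc, x, hx.1.1, hx.1.2, hx.2⟩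

theorem IsTwoPacking.notMem {S : LinearSystem α} {R : Finset (Finset α)} (hR : S.IsTwoPacking R)
    {a b c : Finset α} (ha : a ∈ R) (hb : b ∈ R) (hc : c ∈ R) (hab : a ≠ b) (hac : a ≠ c)
    (hbc : b ≠ c) {x : α} (hxa : x ∈ a) (hxb : x ∈ b) : x ∉ c := by
  intro hxc
  have : x ∈ a ∩ b ∩ c := by simp [hxa, hxb, hxc]
  rw [hR.2 a ha b hb c hc hab hac hbc] at this
  simp at this

/-- A line outside a maximum 2-packing passes through a common point of two of its lines. -/
theorem exists_vertex {S : LinearSystem α} {R : Finset (Finset α)} (hR : S.IsTwoPacking R)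
    (hcard : R.card = S.twoPackingNumber) {m : Finset α} (hm : m ∈ S.lines) (hmR : m ∉ R) :
    ∃ i ∈ R, ∃ j ∈ R, i ≠ j ∧ ∃ x, x ∈ i ∧ x ∈ j ∧ x ∈ m := by
  have hnot : ¬ S.IsTwoPacking (insert m R) := by
    intro h
    have := h.card_le
    rw [Finset.card_insert_of_notMem hmR] at this
    omega
  obtain ⟨a, ha, b, hb, c, hc, hab, hac, hbc, x, hxa, hxb, hxc⟩ :=
    exists_common_of_not_isTwoPacking (Finset.insert_subset hm hR.1) hnot
  rw [Finset.mem_insert] at ha hb hc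
  rcases ha with rfl | ha
  · exact ⟨b, hb.resolve_left hab.symm, c, hc.resolve_left hac.symm, hbc, x, hxb, hxc, hxa⟩
  · rcases hb with rfl | hb
    · exact ⟨a, ha, c, hc.resolve_left hbc.symm, hac, x, hxa, hxc, hxb⟩
    · rcases hc with rfl | hc
      · exact ⟨a, ha, b, hb, hab, x, hxa, hxb, hxc⟩
      · exact absurd hxc (hR.notMem ha hb hc hab hac hbc hxa hxb)

/-- Two lines through different vertices of a triangle that is a maximum 2-packing. -/
theorem false_of_two_vertices {S : LinearSystem α} (hν : S.twoPackingNumber = 3)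
    {R : Finset (Finset α)} (hR : S.IsTwoPacking R) {i j k x z : Finset α} (hi : i ∈ R)
    (hj : j ∈ R) (hk : k ∈ R) (hij : i ≠ j) (hik : i ≠ k) (hjk : j ≠ k) (hx : x ∈ S.lines)
    (hxR : x ∉ R) (hz : z ∈ S.lines) (hzR : z ∉ R) (hxz : x ≠ z) {A C : α} (hAi : A ∈ i)
    (hAj : A ∈ j) (hAx : A ∈ x) (hCj : C ∈ j) (hCk : C ∈ k) (hCz : C ∈ z) : False := by
  have hAC : A ≠ C := by
    rintro rfl
    exact hR.notMem hi hj hk hij hik hjk hAi hAj hCk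
  have ne : ∀ {l m : Finset α}, l ∈ R → m ∉ R → l ≠ m := by
    rintro l m hl hm rfl
    exact hm hl
  have f1 : ∀ p, p ∈ i → p ∈ k → p ∉ z := by
    intro p h1 h2 h3
    have := S.mem_unique (hR.1 hk) hz (ne hk hzR) h2 h3 hCk hCz
    subst this
    exact hR.notMem hi hk hj hik hij hjk.symm h1 h2 hCj
  have f2 : ∀ p, p ∈ i → p ∈ k → p ∉ x := by
    intro p h1 h2 h3
    have := S.mem_unique (hR.1 hi) hx (ne hi hxR) h1 h3 hAi hAx
    subst this
    exact hR.notMem hi hk hj hik hij hjk.symm h1 h2 hAj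
  have f3 : ∀ p, p ∈ i → p ∈ z → p ∉ x := by
    intro p h1 h2 h3
    have := S.mem_unique (hR.1 hi) hx (ne hi hxR) h1 h3 hAi hAx
    subst this
    exact hAC (S.mem_unique (hR.1 hj) hz (ne hj hzR) hAj h2 hCj hCz)
  have f4 : ∀ p, p ∈ k → p ∈ z → p ∉ x := by
    intro p h1 h2 h3
    have := S.mem_unique (hR.1 hk) hz (ne hk hzR) h1 h2 hCk hCz
    subst this
    exact hAC (S.mem_unique (hR.1 hj) hx (ne hj hxR) hAj hAx hCj h3)
  -- Exchanging the side `j`, which carries both vertices `A` and `C`, for `x` and `z` gives a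
  -- 2-packing of four lines.
  have hpack : S.IsTwoPacking {i, k, z, x} := by
    constructor
    · intro l hl
      simp only [Finset.mem_insert, Finset.mem_singleton] at hl
      rcases hl with rfl | rfl | rfl | rfl
      exacts [hR.1 hi, hR.1 hk, hz, hx]
    · intro a ha b hb c hc hab hac hbc
      rw [Finset.eq_empty_iff_forall_notMem]
      intro p hp
      simp only [Finset.mem_inter] at hp
      obtain ⟨⟨h1, h2⟩, h3⟩ := hp
      simp only [Finset.mem_insert, Finset.mem_singleton] at ha hb hc
      have g1 := f1 p
      have g2 := f2 p
      have g3 := f3 p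
      have g4 := f4 p
      clear f1 f2 f3 f4 hν hR
      have key : ∀ l, (l = i ∨ l = k ∨ l = z ∨ l = x) → p ∈ l →
          (l = i ∧ p ∈ i) ∨ (l = k ∧ p ∈ k) ∨ (l = z ∧ p ∈ z) ∨ (l = x ∧ p ∈ x) := by
        rintro l (rfl | rfl | rfl | rfl) hl <;> simp [hl]
      rcases key a ha h1 with ⟨ha, h1⟩ | ⟨ha, h1⟩ | ⟨ha, h1⟩ | ⟨ha, h1⟩ <;>
        rcases key b hb h2 with ⟨hb, h2⟩ | ⟨hb, h2⟩ | ⟨hb, h2⟩ | ⟨hb, h2⟩ <;>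
        first
        | exact hab (ha.trans hb.symm)
        | (rcases key c hc h3 with ⟨hc, h3⟩ | ⟨hc, h3⟩ | ⟨hc, h3⟩ | ⟨hc, h3⟩ <;>
            first
            | exact hac (ha.trans hc.symm)
            | exact hbc (hb.trans hc.symm)
            | (apply g1 <;> assumption)
            | (apply g2 <;> assumption)
            | (apply g3 <;> assumption)
            | (apply g4 <;> assumption))
  have := hpack.card_le
  rw [hν, Finset.card_insert_of_notMem, Finset.card_insert_of_notMem,
    Finset.card_insert_of_notMem, Finset.card_singleton] at this
  · omega
  · simpa using hxz.symm
  · simp only [Finset.mem_insert, Finset.mem_singleton, not_or]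
    exact ⟨ne hk hzR, ne hk hxR⟩
  · simp only [Finset.mem_insert, Finset.mem_singleton, not_or]
    exact ⟨hik, ne hi hzR, ne hi hxR⟩

/-- The lines through a point are at most as many as the points of a line missing it. -/
theorem card_le_of_notMem {S : LinearSystem α} (hS : S.IsIntersecting) {k : Finset α}
    (hk : k ∈ S.lines) {x : α} (hxk : x ∉ k) {F : Finset (Finset α)} (hF : F ⊆ S.lines)
    (hx : ∀ l ∈ F, x ∈ l) : F.card ≤ k.card := by
  have key : ∀ l ∈ F, ∃ p, p ∈ k ∧ p ∈ l := fun l hl =>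
    hS.exists_mem hk (hF hl) (by rintro rfl; exact hxk (hx _ hl))
  have : Nonempty α := ⟨x⟩
  choose! p hpk hpl using key
  refine Finset.card_le_card_of_injOn p hpk ?_
  intro l hl m hm hlm
  by_contra hne
  have h1 := S.mem_unique (hF hl) (hF hm) hne (hx l hl) (hx m hm) (hpl l hl) (hlm ▸ hpl m hm)
  exact hxk (h1 ▸ hpk l hl)

/-- An intersecting system with lines of size three and 2-packing number three has at most four
lines. -/
theorem card_lines_le_four {S : LinearSystem α} (hS : S.IsIntersecting)
    (hν : S.twoPackingNumber = 3) (hcard : ∀ l ∈ S.lines, l.card = 3) : S.lines.card ≤ 4 := by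
  obtain ⟨R, hR, hRc⟩ := S.exists_isTwoPacking
  have hle : (S.lines \ R).card ≤ 1 := by
    rw [Finset.card_le_one]
    intro x hx z hz
    by_contra hxz
    rw [Finset.mem_sdiff] at hx hz
    obtain ⟨hx, hxR⟩ := hx
    obtain ⟨hz, hzR⟩ := hz
    obtain ⟨i, hi, j, hj, hij, A, hAi, hAj, hAx⟩ := exists_vertex hR hRc hx hxR
    obtain ⟨i', hi', j', hj', hij', C, hCi, hCj, hCz⟩ := exists_vertex hR hRc hz hzR
    have ne : ∀ {l m : Finset α}, l ∈ R → m ∉ R → l ≠ m := by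
      rintro l m hl hm rfl
      exact hm hl
    obtain ⟨k, hk⟩ : ∃ k, (R.erase i).erase j = {k} := by
      rw [← Finset.card_eq_one, Finset.card_erase_of_mem (by simp [hj, hij.symm]),
        Finset.card_erase_of_mem hi]
      omega
    have hkR : k ∈ (R.erase i).erase j := by simp [hk]
    simp only [Finset.mem_erase] at hkR
    obtain ⟨hkj, hki, hkR⟩ := hkR
    have hthree : ∀ l ∈ R, l = i ∨ l = j ∨ l = k := by
      intro l hl
      by_cases h1 : l = i
      · exact Or.inl h1
      · by_cases h2 : l = j
        · exact Or.inr (Or.inl h2)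
        · right; right
          rw [← Finset.mem_singleton, ← hk]
          simp [h1, h2, hl]
    -- Four lines through one vertex would need four points on the opposite side `k`.
    have hAC : A ≠ C := by
      rintro rfl
      have hfour : ({i, j, x, z} : Finset (Finset α)).card = 4 := by
        rw [Finset.card_insert_of_notMem, Finset.card_insert_of_notMem,
          Finset.card_insert_of_notMem, Finset.card_singleton]
        · simpa using hxz
        · simp only [Finset.mem_insert, Finset.mem_singleton, not_or]
          exact ⟨ne hj hxR, ne hj hzR⟩
        · simp only [Finset.mem_insert, Finset.mem_singleton, not_or]
          exact ⟨hij, ne hi hxR, ne hi hzR⟩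
      have := card_le_of_notMem hS (hR.1 hkR) (hR.notMem hi hj hkR hij hki.symm hkj.symm hAi hAj)
        (F := {i, j, x, z}) (by
          intro l hl
          simp only [Finset.mem_insert, Finset.mem_singleton] at hl
          rcases hl with rfl | rfl | rfl | rfl
          exacts [hR.1 hi, hR.1 hj, hx, hz]) (by
          intro l hl
          simp only [Finset.mem_insert, Finset.mem_singleton] at hl
          rcases hl with rfl | rfl | rfl | rfl
          exacts [hAi, hAj, hAx, hCz])
      rw [hfour, hcard k (hR.1 hkR)] at this
      omega
    have main : ∀ {a b : Finset α}, a ∈ R → b ∈ R → a ≠ b → C ∈ a → C ∈ b → a = i ∨ a = j →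
        False := by
      intro a b ha hb hab hCa hCb h
      rcases h with rfl | rfl
      · have hbj : j ≠ b := by
          rintro rfl
          exact hAC (S.mem_unique (hR.1 ha) (hR.1 hb) hab hAi hAj hCa hCb)
        exact false_of_two_vertices hν hR hj ha hb hij.symm hbj hab hx hxR hz hzR hxz hAj hAi hAx
          hCa hCb hCz
      · have hbi : i ≠ b := by
          rintro rfl
          exact hAC (S.mem_unique (hR.1 ha) (hR.1 hb) hab hAj hAi hCa hCb)
        exact false_of_two_vertices hν hR hi ha hb hij hbi hab hx hxR hz hzR hxz hAi hAj hAx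
          hCa hCb hCz
    rcases hthree i' hi' with h1 | h1 | h1
    · exact main hi' hj' hij' hCi hCj (Or.inl h1)
    · exact main hi' hj' hij' hCi hCj (Or.inr h1)
    · rcases hthree j' hj' with h2 | h2 | h2
      · exact main hj' hi' hij'.symm hCj hCi (Or.inl h2)
      · exact main hj' hi' hij'.symm hCj hCi (Or.inr h2)
      · exact hij' (h1.trans h2.symm)
  have := Finset.card_sdiff_add_card_eq_card hR.1
  omega

/-- Pairing up the lines of an intersecting system gives a set of points meeting all of them. -/
theorem exists_pairing {S : LinearSystem α} (hS : S.IsIntersecting)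
    (hne : ∀ l ∈ S.lines, l.Nonempty) : ∀ (n : ℕ) (M : Finset (Finset α)), M ⊆ S.lines →
      M.card = n → ∃ T ⊆ S.points, (∀ l ∈ M, (T ∩ l).Nonempty) ∧ T.card ≤ (n + 1) / 2 := by
  intro n
  induction n using Nat.strong_induction_on with
  | _ n ih =>
    intro M hM hn
    rcases Nat.lt_or_ge 1 n with h2 | h2
    · obtain ⟨a, ha, b, hb, hab⟩ := Finset.one_lt_card.mp (hn ▸ h2)
      obtain ⟨x, hxa, hxb⟩ := hS.exists_mem (hM ha) (hM hb) hab
      have hc : ((M.erase a).erase b).card = n - 2 := by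
        rw [Finset.card_erase_of_mem (by simp [hb, hab.symm]), Finset.card_erase_of_mem ha, hn]
        omega
      obtain ⟨T, hT, hTM, hTc⟩ := ih (n - 2) (by omega) ((M.erase a).erase b)
        (fun l hl => hM (Finset.mem_of_mem_erase (Finset.mem_of_mem_erase hl))) hc
      refine ⟨insert x T, Finset.insert_subset (S.subset_points a (hM ha) hxa) hT, ?_, ?_⟩
      · intro l hl
        by_cases hla : l = a
        · exact ⟨x, by simp [hla, hxa]⟩
        · by_cases hlb : l = b
          · exact ⟨x, by simp [hlb, hxb]⟩
          · exact (hTM l (by simp [hla, hlb, hl])).mono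
              (Finset.inter_subset_inter_right (Finset.subset_insert _ _))
      · have := Finset.card_insert_le x T
        omega
    · rcases Finset.eq_empty_or_nonempty M with rfl | ⟨a, ha⟩
      · exact ⟨∅, by simp, by simp, by simp⟩
      · obtain ⟨x, hx⟩ := hne a (hM ha)
        have hpos := Finset.card_pos.mpr ⟨a, ha⟩
        refine ⟨{x}, by simpa using S.subset_points a (hM ha) hx, ?_, by
          rw [Finset.card_singleton]; omega⟩
        intro l hl
        rw [Finset.card_le_one.mp (by omega) l hl a ha]
        exact ⟨x, by simp [hx]⟩

theorem transversalNumber_le {S : LinearSystem α} {T : Finset α} (hT : S.IsTransversal T) :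
    S.transversalNumber ≤ T.card :=
  Nat.sInf_le ⟨T, hT, rfl⟩

theorem transversalNumber_le_half {S : LinearSystem α} (hS : S.IsIntersecting)
    (hne : ∀ l ∈ S.lines, l.Nonempty) : S.transversalNumber ≤ (S.lines.card + 1) / 2 := by
  obtain ⟨T, hT, hTM, hTc⟩ := exists_pairing hS hne _ S.lines subset_rfl rfl
  exact (transversalNumber_le ⟨hT, hTM⟩).trans hTc

/-- If the lines do not form a 2-packing, three of them can be met by a single point. -/
theorem transversalNumber_le_of_lt {S : LinearSystem α} (hS : S.IsIntersecting)
    (hne : ∀ l ∈ S.lines, l.Nonempty) (hlt : S.twoPackingNumber < S.lines.card) :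
    S.transversalNumber ≤ (S.lines.card - 2) / 2 + 1 := by
  have hnot : ¬ S.IsTwoPacking S.lines := fun h => by
    have := h.card_le
    omega
  obtain ⟨a, ha, b, hb, c, hc, hab, hac, hbc, x, hxa, hxb, hxc⟩ :=
    exists_common_of_not_isTwoPacking subset_rfl hnot
  have hcard : (((S.lines.erase a).erase b).erase c).card = S.lines.card - 3 := by
    rw [Finset.card_erase_of_mem (by simp [hc, hbc.symm, hac.symm]),
      Finset.card_erase_of_mem (by simp [hb, hab.symm]), Finset.card_erase_of_mem ha]
    omega
  obtain ⟨T, hT, hTM, hTc⟩ := exists_pairing hS hne _ (((S.lines.erase a).erase b).erase c)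
    (fun l hl => Finset.mem_of_mem_erase (Finset.mem_of_mem_erase (Finset.mem_of_mem_erase hl)))
    hcard
  have htr : S.IsTransversal (insert x T) := by
    refine ⟨Finset.insert_subset (S.subset_points a ha hxa) hT, ?_⟩
    intro l hl
    by_cases hla : l = a
    · exact ⟨x, by simp [hla, hxa]⟩
    · by_cases hlb : l = b
      · exact ⟨x, by simp [hlb, hxb]⟩
      · by_cases hlc : l = c
        · exact ⟨x, by simp [hlc, hxc]⟩
        · exact (hTM l (by simp [hla, hlb, hlc, hl])).mono
            (Finset.inter_subset_inter_right (Finset.subset_insert _ _))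
  have h3 : 3 ≤ S.lines.card := by
    have h4 : ({a, b, c} : Finset (Finset α)) ⊆ S.lines := by
      intro l hl
      simp only [Finset.mem_insert, Finset.mem_singleton] at hl
      rcases hl with rfl | rfl | rfl
      exacts [ha, hb, hc]
    have h5 := Finset.card_le_card h4
    rwa [Finset.card_eq_three.mpr ⟨a, b, c, hab, hac, hbc, rfl⟩] at h5
  have h6 := Finset.card_insert_le x T
  have h7 := transversalNumber_le htr
  omega

end LinearSystem

/-! ### From segments of real lines to integer progressions -/

theorem intPoint_add_smul (x d : ℤ × ℤ) (t : ℤ) :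
    intPoint (x + t • d) = intPoint x + (t : ℝ) • intPoint d := by
  ext <;> simp [intPoint]

theorem intPoint_ne_zero {d : ℤ × ℤ} (hd : d ≠ 0) : intPoint d ≠ 0 := by
  intro h
  apply hd
  simpa [intPoint, Prod.ext_iff] using h

/-- The straight line through `x` with direction `d`. -/
noncomputable def planeLine (x d : ℤ × ℤ) : AffineSubspace ℝ (ℝ × ℝ) :=
  AffineSubspace.mk' (intPoint x) (Submodule.span ℝ {intPoint d})

theorem isPlaneLine_planeLine (x : ℤ × ℤ) {d : ℤ × ℤ} (hd : d ≠ 0) :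
    IsPlaneLine (planeLine x d) := by
  rw [IsPlaneLine, planeLine, AffineSubspace.direction_mk']
  exact finrank_span_singleton (intPoint_ne_zero hd)

theorem intPoint_mem_planeLine {x d v : ℤ × ℤ} (hd : d ≠ 0) (h : cross d v = 0) :
    intPoint (x + v) ∈ planeLine x d := by
  rw [planeLine, AffineSubspace.mem_mk', Submodule.mem_span_singleton]
  have hR : (d.1 : ℝ) * v.2 = d.2 * v.1 := by
    unfold cross at h
    exact_mod_cast sub_eq_zero.mp h
  by_cases h1 : d.1 = 0
  · have h2 : d.2 ≠ 0 := fun h2 => hd (Prod.ext h1 h2)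
    have h2' : (d.2 : ℝ) ≠ 0 := by exact_mod_cast h2
    have h3 : (v.1 : ℝ) = 0 := by
      rw [h1] at hR
      simpa [h2'] using hR.symm
    refine ⟨v.2 / d.2, ?_⟩
    ext
    · simp [intPoint, h1, h3]
    · simp [intPoint, h2']
  · have h1' : (d.1 : ℝ) ≠ 0 := by exact_mod_cast h1
    refine ⟨v.1 / d.1, ?_⟩
    ext
    · simp [intPoint, h1']
    · simp [intPoint]
      field_simp
      linarith

theorem cross_eq_zero_of_mem {M : AffineSubspace ℝ (ℝ × ℝ)} (hM : IsPlaneLine M) {x y z : ℤ × ℤ}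
    (hx : intPoint x ∈ M) (hy : intPoint y ∈ M) (hz : intPoint z ∈ M) :
    cross (y - x) (z - x) = 0 := by
  obtain ⟨v, -, hv⟩ := finrank_eq_one_iff'.mp hM
  obtain ⟨a, ha⟩ := hv ⟨_, AffineSubspace.vsub_mem_direction hy hx⟩
  obtain ⟨b, hb⟩ := hv ⟨_, AffineSubspace.vsub_mem_direction hz hx⟩
  have ha' := congrArg Subtype.val ha
  have hb' := congrArg Subtype.val hb
  simp only [SetLike.val_smul, vsub_eq_sub, intPoint, Prod.ext_iff, Prod.smul_fst, Prod.smul_snd,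
    Prod.fst_sub, Prod.snd_sub, smul_eq_mul] at ha' hb'
  have : ((cross (y - x) (z - x) : ℤ) : ℝ) = 0 := by
    simp only [cross, Prod.fst_sub, Prod.snd_sub]
    push_cast
    rw [← ha'.1, ← ha'.2, ← hb'.1, ← hb'.2]
    ring
  exact_mod_cast this

theorem intPoint_mem_segment (p d : ℤ × ℤ) {a b c : ℤ} (hab : a ≤ b) (hbc : b ≤ c) :
    intPoint (p + b • d) ∈ segment ℝ (intPoint (p + a • d)) (intPoint (p + c • d)) := by
  have h1 : (a : ℝ) ≤ b := by exact_mod_cast hab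
  have h2 : (b : ℝ) ≤ c := by exact_mod_cast hbc
  rcases eq_or_lt_of_le (h1.trans h2) with h3 | h3
  · obtain rfl : a = c := by exact_mod_cast h3
    obtain rfl : a = b := by omega
    exact left_mem_segment ℝ _ _
  · have h4 : (0 : ℝ) < c - a := by linarith
    refine ⟨(c - b) / (c - a), (b - a) / (c - a), div_nonneg (by linarith) h4.le,
      div_nonneg (by linarith) h4.le, ?_, ?_⟩
    · field_simp
      ring
    · simp only [intPoint_add_smul]
      ext <;> simp <;> field_simp <;> ring

/-- A finite set of integers without gaps is an interval. -/
theorem exists_eq_Ico_of_ordConnected {I : Finset ℤ} (hI : I.Nonempty)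
    (h : ∀ a ∈ I, ∀ c ∈ I, ∀ b, a ≤ b → b ≤ c → b ∈ I) : ∃ w : ℤ, I = Finset.Ico w (w + (I.card : ℤ)) := by
  have h1 : I = Finset.Icc (I.min' hI) (I.max' hI) := by
    ext b
    rw [Finset.mem_Icc]
    exact ⟨fun hb => ⟨I.min'_le _ hb, I.le_max' _ hb⟩,
      fun hb => h _ (I.min'_mem hI) _ (I.max'_mem hI) b hb.1 hb.2⟩
  have h2 : I.min' hI ≤ I.max' hI := I.min'_le _ (I.max'_mem hI)
  have h3 := congrArg Finset.card h1
  rw [Int.card_Icc] at h3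
  refine ⟨I.min' hI, ?_⟩
  ext b
  rw [Finset.mem_Ico]
  nth_rewrite 1 [h1]
  rw [Finset.mem_Icc]
  omega

/-- Dividing `q - p` by the gcd of its coordinates gives a primitive step. Bézout coefficients then
define an integral coordinate `k` along the line, and convexity makes its values an interval. -/
theorem IsConsecutiveOn.exists_segOn {M : AffineSubspace ℝ (ℝ × ℝ)} (hM : IsPlaneLine M) {r : ℕ}
    (hr : 2 ≤ r) {l : Finset (ℤ × ℤ)} (h : IsConsecutiveOn M r l) : ∃ p d, SegOn r l p d := by
  obtain ⟨hcard, hmem, hconv⟩ := h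
  obtain ⟨p, hp, q, hq, hpq⟩ := Finset.one_lt_card.mp (by omega : 1 < l.card)
  have hpos : 0 < Int.gcd (q - p).1 (q - p).2 := by
    rw [Int.gcd_pos_iff]
    by_contra! hcon
    exact hpq (sub_eq_zero.mp (Prod.ext hcon.1 hcon.2 : q - p = 0)).symm
  obtain ⟨a, b, hab, h1, h2⟩ := Int.exists_gcd_one hpos
  obtain ⟨u, v, huv⟩ := (Int.isCoprime_iff_gcd_eq_one.mpr hab)
  have hd : ((a, b) : ℤ × ℤ) ≠ 0 := by
    intro h0
    simp only [Prod.mk_eq_zero] at h0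
    rw [h0.1, h0.2] at huv
    simp at huv
  let k : ℤ × ℤ → ℤ := fun x => u * (x - p).1 + v * (x - p).2
  have hk : ∀ x ∈ l, x = p + k x • ((a, b) : ℤ × ℤ) := by
    intro x hx
    have hc := cross_eq_zero_of_mem hM (hmem p hp) (hmem q hq) (hmem x hx)
    unfold cross at hc
    have hg : ((Int.gcd (q - p).1 (q - p).2 : ℕ) : ℤ) ≠ 0 := by exact_mod_cast hpos.ne'
    have hc' : a * (x - p).2 = b * (x - p).1 := by
      apply mul_left_cancel₀ hg
      linear_combination hc - (x - p).2 * h1 + (x - p).1 * h2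
    have e1 : (x - p).1 = k x * a := by
      simp only [k]
      linear_combination (-(x - p).1) * huv - v * hc'
    have e2 : (x - p).2 = k x * b := by
      simp only [k]
      linear_combination (-(x - p).2) * huv + u * hc'
    rw [Prod.fst_sub] at e1
    rw [Prod.snd_sub] at e2
    ext
    · simp only [Prod.fst_add, Prod.smul_fst, smul_eq_mul]
      linarith
    · simp only [Prod.snd_add, Prod.smul_snd, smul_eq_mul]
      linarith
  have hinj : Set.InjOn k l := by
    intro x hx y hy hxy
    rw [hk x hx, hk y hy, hxy]
  have hmemI : ∀ t : ℤ, t ∈ l.image k ↔ p + t • ((a, b) : ℤ × ℤ) ∈ l := by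
    intro t
    rw [Finset.mem_image]
    constructor
    · rintro ⟨x, hx, rfl⟩
      rw [← hk x hx]
      exact hx
    · intro ht
      exact ⟨_, ht, (smul_right_inj_int hd (add_left_cancel (hk _ ht))).symm⟩
  obtain ⟨w, hw⟩ := exists_eq_Ico_of_ordConnected (I := l.image k) ⟨k p, by
      rw [Finset.mem_image]; exact ⟨p, hp, rfl⟩⟩ (by
    intro s hs t ht c hsc hct
    rw [hmemI] at *
    exact hconv _ hs _ ht _ (intPoint_mem_segment p _ hsc hct))
  rw [Finset.card_image_of_injOn hinj, hcard] at hw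
  refine ⟨p, (a, b), w, hd, fun x => ⟨fun hx => ?_, ?_⟩⟩
  · refine ⟨k x, ?_, ?_, hk x hx⟩
    all_goals
      have : k x ∈ l.image k := Finset.mem_image_of_mem _ hx
      rw [hw, Finset.mem_Ico] at this
      omega
  · rintro ⟨t, ht1, ht2, rfl⟩
    rw [← hmemI, hw, Finset.mem_Ico]
    exact ⟨ht1, ht2⟩

/-- Two lines with proportional steps and a common point would lie on one straight line, which
carries at most one line of the system. -/
theorem IsSegmentSystem.isArrangement {r : ℕ} {S : LinearSystem (ℤ × ℤ)}
    (hS : IsSegmentSystem r S) (hint : S.IsIntersecting) : IsArrangement r S.lines where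
  two_le := hS.1
  seg l hl := by
    obtain ⟨M, hM, h⟩ := hS.2.1 l hl
    exact h.exists_segOn hM hS.1
  meet l hl m hm hlm := hint.exists_mem hl hm hlm
  cross_ne := by
    intro l hl m hm hlm p d p' d' h h' hc
    obtain ⟨x, hxl, hxm⟩ := hint.exists_mem hl hm hlm
    refine hlm (hS.2.2 _ (isPlaneLine_planeLine x h.step_ne_zero) l hl m hm ?_ ?_)
    · intro y hy
      obtain ⟨t, rfl⟩ := (h.rebase hxl).exists_eq hy
      refine intPoint_mem_planeLine h.step_ne_zero ?_
      simp [cross]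
      ring
    · intro y hy
      obtain ⟨t, rfl⟩ := (h'.rebase hxm).exists_eq hy
      refine intPoint_mem_planeLine h.step_ne_zero ?_
      have : cross d (t • d') = t * cross d d' := by
        simp [cross]
        ring
      rw [this, hc, mul_zero]

theorem IsArrangement.mono {r : ℕ} {L R : Finset (Finset (ℤ × ℤ))} (hL : IsArrangement r L)
    (h : R ⊆ L) : IsArrangement r R :=
  ⟨hL.two_le, fun l hl => hL.seg l (h hl), fun l hl m hm => hL.meet l (h hl) m (h hm),
    fun l hl m hm => hL.cross_ne l (h hl) m (h hm)⟩

theorem IsSegmentSystem.card_lines_le {S : LinearSystem (ℤ × ℤ)} (hint : S.IsIntersecting)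
    (hseg : IsSegmentSystem S.twoPackingNumber S) (hν : 3 ≤ S.twoPackingNumber) :
    S.lines.card ≤ S.twoPackingNumber + 1 ∨
      (S.twoPackingNumber = 4 ∧ S.lines.card ≤ 6) := by
  rcases eq_or_lt_of_le hν with h3 | h4
  · left
    rw [← h3]
    refine LinearSystem.card_lines_le_four hint h3.symm fun l hl => ?_
    obtain ⟨M, -, h, -⟩ := hseg.2.1 l hl
    rw [h, ← h3]
  · obtain ⟨R, hR, hRc⟩ := S.exists_isTwoPacking
    have hL := hseg.isArrangement hint
    have hT : IsTightArrangement S.twoPackingNumber R :=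
      ⟨hL.mono hR.1, hRc, fun a ha b hb c hc hab hac hbc x hxa hxb =>
        hR.notMem ha hb hc hab hac hbc hxa hxb⟩
    exact hT.card_le h4 hL hR.1

theorem mainTheorem5 (S : LinearSystem (ℤ × ℤ))
    (hint : S.IsIntersecting)
    (hseg : IsSegmentSystem S.twoPackingNumber S)
    (hν : 3 ≤ S.twoPackingNumber) :
    (S.lines.card : ℝ) ≤ (3 * (S.twoPackingNumber : ℝ) + 1) / 2 ∧
    (S.transversalNumber : ℝ) ≤ 2 / 3 * ((S.twoPackingNumber : ℝ) + 1) := by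
  have hcard := IsSegmentSystem.card_lines_le hint hseg hν
  have hne : ∀ l ∈ S.lines, l.Nonempty := by
    intro l hl
    obtain ⟨M, -, h, -⟩ := hseg.2.1 l hl
    exact Finset.card_pos.mp (by omega)
  have h1 : 2 * S.lines.card ≤ 3 * S.twoPackingNumber + 1 := by omega
  have h2 : 3 * S.transversalNumber ≤ 2 * (S.twoPackingNumber + 1) := by
    have := LinearSystem.transversalNumber_le_half hint hne
    rcases le_or_gt S.lines.card S.twoPackingNumber with hle | hlt
    · omega
    · have := LinearSystem.transversalNumber_le_of_lt hint hne hlt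
      omega
  have h1' : (2 : ℝ) * S.lines.card ≤ 3 * S.twoPackingNumber + 1 := by exact_mod_cast h1
  have h2' : (3 : ℝ) * S.transversalNumber ≤ 2 * (S.twoPackingNumber + 1) := by exact_mod_cast h2
  constructor <;> linarith
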